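/- **Setting.** For $r\ge 0$ let $\mathcal C=C([-r,0],\mathbb R^d)$ with the maximum norm, and write $u_t(\theta)=u(t+\theta)$, $\theta\in[-r,0]$. An $s$-stage two-step Runge–Kutta (TSRK) method for retarded functional differential equations $y'(t)=f(t,y_t)$ is given by abscissae $c_i\ge 0$ and real polynomials $a_{ij},\tilde a_{ij},u_i$ (used on $[0,c_i]$) and $b_j,\tilde b_j,v$ (used on $[0,1]$), $i,j=1,\dots,s$, with $a_{ij}(0)=\tilde a_{ij}(0)=b_j(0)=\tilde b_j(0)=0$ and $u_i(0)=v(0)=1$. On the mesh $t_n=t_0+nh$, $h=(T-t_0)/N$, its $n$-th step computes from $\eta^{[n-1]}:[-r,h]\to\mathbb R^d$ and $K^{[n-1]}_j\in\mathbb R^d$ continuous functions $\eta^{[n]}$ on $[-r,h]$ and $Y^{[n]i}$ on $[-r,c_ih]$, and $K_i^{[n]}\in\mathbb R^d$, with $$\eta^{[n]}(\alpha h)=(1-v(\alpha))\eta^{[n-1]}(0)+v(\alpha)\eta^{[n-1]}(h)+h\sum_{j}\tilde b_j(\alpha)K_j^{[n-1]}+h\sum_{j} b_j(\alpha)K_j^{[n]},\quad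 \alpha\in[0,1],$$ $$Y^{[n]i}(\alpha h)=(1-u_i(\alpha))\eta^{[n-1]}(0)+u_i(\alpha)\eta^{[n-1]}(h)+h\sum_{j}\tilde a_{ij}(\alpha)K_j^{[n-1]}+h\sum_{j} a_{ij}(\alpha)K_j^{[n]},\quad \alpha\in[0,c_i],$$ $$K_i^{[n]}=f(t_{n-1}+c_ih,\,Y^{[n]i}_{c_ih}),\qquad \eta^{[n]}(\theta)=Y^{[n]i}(\theta)=\eta^{[n-1]}(h+\theta),\quad\theta\in[-r,0].$$ For $k\ge 1$ put $$\Gamma_{ik}(\alpha)=\frac1{(k-1)!}\Bigl[\frac{(1-u_i(\alpha))(-1)^k}{k}+\sum_{j=1}^s\tilde a_{ij}(\alpha)(-(1-c_j))^{k-1}+\sum_{j=1}^s a_{ij}(\alpha)c_j^{k-1}-\frac{\alpha^k}{k}\Bigr],\quad \alpha\in[0,c_i],$$ and let $\Gamma_k(\alpha)$, $\alpha\in[0,1]$, be given by the same formula with $v,\tilde b_j,b_j$ in place of $u_i,\tilde a_{ij},a_{ij}$. **Problems.** A $C^{l,m}$-problem consists of $d$, $r\ge0$, a continuous $f:\mathbb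 R\times\mathcal C\to\mathbb R^d$ with bounded first derivative with respect to the second argument and of class $C^l$ with respect to it (the derivatives of order $\le l$ with respect to the second argument being bounded near every point of $\mathbb R\times\mathcal C$), numbers $\sigma\le t_0<T\le\tau$, and a continuous $y$ on $[\sigma-r,\tau]$ with $y'(t)=f(t,y_t)$ on $[\sigma,\tau]$ that is of piecewise class $C^m$ on $[\sigma,\tau]$: for some finite set of break points, $y$ is $C^m$ on every closed subinterval of $[\sigma,\tau]$ with no break point in its interior. The $n$-th step is *regular* if $[t_{n-2},\,t_{n-1}+\max(1,c_1,\dots,c_s)h]$ is contained in $[\sigma,\tau]$ and has no break point in its interior. **Order.** Let $q\ge 1$ be an integer. In both definitions the constant in $O(\cdot)$ may depend on the method and the problem, but not on $N$, $n$, $\alpha$, and the maximum is over the $n\in\{1,\dots,N\}$ for which the $n$-th step is regular. (i) The method has *uniform order $q$ in the sense of the one-step error* if there are $l,m$ such that for every $C^{l,m}$-problem and all sufficiently large $N$ each regular $n$-th step with the exact input $\eta^{[n-1]}(\theta)=y(t_{n-2}+\theta)$, $K^{[n-1]}_j=y'(t_{n-2}+c_jh)$ can be carried out, and its results satisfy $\max_n\max_{\alpha\in[0,1]}\|y(t_{n-1}+\alpha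 h)-\eta^{[n]}(\alpha h)\|=O(h^{q+1})$ as $h\to0$. (ii) The method has *uniform order of consistency $q$* if there are $l,m$ such that for every $C^{l,m}$-problem $\max_n\max_{\alpha\in[0,1]}\|d^{[n]}(\alpha)\|=O(h^q)$ as $h\to0$, where $d^{[n]}$ is the residual of the exact solution, defined by $$h\,d^{[n]}(\alpha)=y(t_{n-1}+\alpha h)-(1-v(\alpha))y(t_{n-2})-v(\alpha)y(t_{n-1})-h\sum_{j=1}^s\tilde b_j(\alpha)y'(t_{n-2}+c_jh)-h\sum_{j=1}^s b_j(\alpha)y'(t_{n-1}+c_jh).$$ **Theorem.** Suppose that the TSRK method satisfies the stage order one conditions $$v(\alpha)-1+\sum_j\tilde b_j(\alpha)+\sum_j b_j(\alpha)=\alpha\ \ (\alpha\in[0,1]),\qquad u_i(\alpha)-1+\sum_j\tilde a_{ij}(\alpha)+\sum_j a_{ij}(\alpha)=\alpha\ \ (\alpha\in[0,c_i],\ i=1,\dots,s).$$ Let $c_1^*<\dots<c_{s^*}^*$ be the distinct values among $c_1,\dots,c_s$, and suppose that for all $\alpha\in[0,1]$, $l,m\in\{1,\dots,s^*\}$, $\beta\in[0,c_m^*]$,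 $\gamma\in[0,c_l^*]$ $$\Gamma_4(\alpha)=0,\qquad \sum_{i:\,c_i=c_m^*}b_i(\alpha)\Gamma_{i3}(\beta)=0,\qquad \sum_{i:\,c_i=c_m^*}\ \sum_{j:\,c_j=c_l^*}b_i(\alpha)a_{ij}(\beta)\Gamma_{j2}(\gamma)=0.$$ If the method has uniform order three, then it has uniform order four. This holds with "uniform order" understood in the sense (i) throughout, and also with it understood in the sense (ii) throughout. -/

import Mathlib

open Set Filter Topology

noncomputable section

/-- The coefficients of an `s`-stage two-step Runge-Kutta (TSRK) method for retarded functional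
differential equations.  `a i j`, `aT i j` (written `ã i j`) and `u i` are used on `[0, c i]`,
`b j`, `bT j` (written `b̃ j`) and `v` on `[0, 1]`. -/
structure TSRK (s : ℕ) where
  a : Fin s → Fin s → Polynomial ℝ
  b : Fin s → Polynomial ℝ
  c : Fin s → ℝ
  aT : Fin s → Fin s → Polynomial ℝ
  bT : Fin s → Polynomial ℝ
  u : Fin s → Polynomial ℝ
  v : Polynomial ℝ
  c_nonneg : ∀ i, 0 ≤ c i
  a_zero : ∀ i j, (a i j).eval 0 = 0
  aT_zero : ∀ i j, (aT i j).eval 0 = 0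
  u_zero : ∀ i, (u i).eval 0 = 1
  b_zero : ∀ j, (b j).eval 0 = 0
  bT_zero : ∀ j, (bT j).eval 0 = 0
  v_zero : v.eval 0 = 1

/-- The space of continuous functions `[-r, 0] → E`, with the maximum norm. -/
abbrev Hist (r : ℝ) (E : Type) [NormedAddCommGroup E] : Type := C(Icc (-r) (0 : ℝ), E)

/-- The shift `u_t`, i.e. `u_t(θ) = u(t + θ)` for `θ ∈ [-r, 0]`. -/
def shift {E : Type} [NormedAddCommGroup E] (r : ℝ) (u : C(ℝ, E)) (t : ℝ) : Hist r E where
  toFun θ := u (t + θ)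
  continuous_toFun := by fun_prop

/-- The standing assumptions on the right-hand side `f : ℝ × C([-r,0], E) → E`: it is continuous,
has a bounded first derivative with respect to the second argument, and is of class `C^l` with
respect to the second argument, where the derivatives of order at most `l` are bounded in a
neighbourhood of every point of `ℝ × C([-r,0], E)`. -/
structure IsSmoothRHS {E : Type} [NormedAddCommGroup E] [NormedSpace ℝ E] (r : ℝ) (l : ℕ)
    (f : ℝ → Hist r E → E) : Prop where
  continuous : Continuous fun p : ℝ × Hist r E => f p.1 p.2
  differentiable : ∀ t, Differentiable ℝ (f t)
  bounded_fderiv : ∃ L : ℝ, ∀ t φ, ‖fderiv ℝ (f t) φ‖ ≤ L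
  contDiff : ∀ t, ContDiff ℝ l (f t)
  locally_bounded : ∀ k : ℕ, k ≤ l → ∀ t φ, ∃ C : ℝ,
    ∀ᶠ p : ℝ × Hist r E in 𝓝 (t, φ), ‖iteratedFDeriv ℝ k (f p.1) p.2‖ ≤ C

/-- A problem `y'(t) = f(t, y_t)` with a right-hand side of class `C^l` in the second argument, to
be integrated over `[t₀, T]`, together with an exact solution `y` on an interval
`[σ, τ] ⊇ [t₀, T]`, which is of piecewise class `C^m` there: it is `C^m` on each closed subinterval
of `[σ, τ]` that has no point of the finite set `breaks` in its interior.  Before `σ` the function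
`y` is merely continuous (the values of `y` outside `[σ - r, τ]` play no role). -/
structure SmoothProblem (l m : ℕ) where
  d : ℕ
  r : ℝ
  r_nonneg : 0 ≤ r
  f : ℝ → Hist r (EuclideanSpace ℝ (Fin d)) → EuclideanSpace ℝ (Fin d)
  rhs : IsSmoothRHS r l f
  σ : ℝ
  t₀ : ℝ
  T : ℝ
  τ : ℝ
  σ_le : σ ≤ t₀
  t₀_lt : t₀ < T
  le_τ : T ≤ τ
  y : C(ℝ, EuclideanSpace ℝ (Fin d))
  solution : ∀ t ∈ Icc σ τ, HasDerivWithinAt y (f t (shift r y t)) (Icc σ τ) t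
  breaks : Finset ℝ
  piecewise : ∀ p q : ℝ, σ ≤ p → p < q → q ≤ τ → (∀ x ∈ breaks, x ∉ Ioo p q) →
    ContDiffOn ℝ m y (Icc p q)

namespace SmoothProblem

variable {l m : ℕ} (P : SmoothProblem l m)

/-- The stepsize `h = (T - t₀) / N`. -/
def step (N : ℕ) : ℝ := (P.T - P.t₀) / N

/-- The mesh point `t_k = t₀ + k h`; `k` is an integer since `t_{-1} = t₀ - h` is used. -/
def mesh (N : ℕ) (k : ℤ) : ℝ := P.t₀ + k * P.step N

/-- The exact value `y'(t) = f(t, y_t)` of a stage. -/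
def exactK (t : ℝ) : EuclideanSpace ℝ (Fin P.d) := P.f t (shift P.r P.y t)

end SmoothProblem

namespace TSRK

variable {s : ℕ} (M : TSRK s)

/-- `Γ_{ik}(α)`, for `k ≥ 1` and `α ∈ [0, c_i]`. -/
def gammaStage (i : Fin s) (k : ℕ) (α : ℝ) : ℝ :=
  1 / ((k - 1).factorial : ℝ) *
    ((1 - (M.u i).eval α) * (-1) ^ k / k + ∑ j, (M.aT i j).eval α * (-(1 - M.c j)) ^ (k - 1)
      + ∑ j, (M.a i j).eval α * M.c j ^ (k - 1) - α ^ k / k)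

/-- `Γ_k(α)`, for `k ≥ 1` and `α ∈ [0, 1]`. -/
def gamma (k : ℕ) (α : ℝ) : ℝ :=
  1 / ((k - 1).factorial : ℝ) *
    ((1 - M.v.eval α) * (-1) ^ k / k + ∑ j, (M.bT j).eval α * (-(1 - M.c j)) ^ (k - 1)
      + ∑ j, (M.b j).eval α * M.c j ^ (k - 1) - α ^ k / k)

/-- The conditions of uniform stage order one. -/
def StageOrderOne : Prop :=
  (∀ α ∈ Icc (0 : ℝ) 1, M.v.eval α - 1 + ∑ j, (M.bT j).eval α + ∑ j, (M.b j).eval α = α) ∧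
  ∀ i, ∀ α ∈ Icc (0 : ℝ) (M.c i),
    (M.u i).eval α - 1 + ∑ j, (M.aT i j).eval α + ∑ j, (M.a i j).eval α = α

/-- One step of the method, from `t = t_{n-1}` to `t_n = t + h`.  Here `η₀ = η^[n-1]` (on `[-r, h]`)
and `K₀ = K^[n-1]` come from the preceding step, `η = η^[n]` (on `[-r, h]`), `K = K^[n]` and
`Y i = Y^{[n] i}` (on `[-r, c_i h]`) are the unknowns; the values of these continuous functions
outside the intervals mentioned play no role. -/
structure IsStep {E : Type} [NormedAddCommGroup E] [NormedSpace ℝ E] (r : ℝ)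
    (f : ℝ → Hist r E → E) (h t : ℝ) (η₀ : C(ℝ, E)) (K₀ : Fin s → E)
    (η : C(ℝ, E)) (K : Fin s → E) (Y : Fin s → C(ℝ, E)) : Prop where
  eta : ∀ α ∈ Icc (0 : ℝ) 1, η (α * h) = (1 - M.v.eval α) • η₀ 0 + M.v.eval α • η₀ h
    + h • ∑ j, (M.bT j).eval α • K₀ j + h • ∑ j, (M.b j).eval α • K j
  stage_value : ∀ i, K i = f (t + M.c i * h) (shift r (Y i) (M.c i * h))
  stage : ∀ i, ∀ α ∈ Icc (0 : ℝ) (M.c i),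
    Y i (α * h) = (1 - (M.u i).eval α) • η₀ 0 + (M.u i).eval α • η₀ h
      + h • ∑ j, (M.aT i j).eval α • K₀ j + h • ∑ j, (M.a i j).eval α • K j
  eta_past : ∀ θ ∈ Icc (-r) 0, η θ = η₀ (h + θ)
  stage_past : ∀ i, ∀ θ ∈ Icc (-r) 0, Y i θ = η₀ (h + θ)

/-- `max(1, c_1, …, c_s)`: the step from `t_{n-1}` involves times up to `t_{n-1} + reach * h`. -/
def reach : ℝ := max 1 (⨆ i, M.c i)

/-- The `n`-th step involves times in `[t_{n-2}, t_{n-1} + reach * h]`.  It is regular if `y` is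
an exact solution on this interval and no break point of `y` lies in the interior. -/
def RegularStep {l m : ℕ} (P : SmoothProblem l m) (N n : ℕ) : Prop :=
  P.σ ≤ P.mesh N (n - 2) ∧ P.mesh N (n - 1) + M.reach * P.step N ≤ P.τ ∧
  ∀ x ∈ P.breaks, x ∉ Ioo (P.mesh N (n - 2)) (P.mesh N (n - 1) + M.reach * P.step N)

/-- The local discretization error `d^{[n], s+1}` at the time `t_{n-1} + α h`: the residual, divided
by `h`, of the exact values in the equation for `η^[n]`.  (At the times up to `t_{n-1}` it
vanishes.) -/
def residual {l m : ℕ} (P : SmoothProblem l m) (N n : ℕ) (α : ℝ) : EuclideanSpace ℝ (Fin P.d) :=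
  (P.step N)⁻¹ • (P.y (P.mesh N (n - 1) + α * P.step N)
    - ((1 - M.v.eval α) • P.y (P.mesh N (n - 2)) + M.v.eval α • P.y (P.mesh N (n - 1))
      + P.step N • ∑ j, (M.bT j).eval α • P.exactK (P.mesh N (n - 2) + M.c j * P.step N)
      + P.step N • ∑ j, (M.b j).eval α • P.exactK (P.mesh N (n - 1) + M.c j * P.step N)))

/-- Uniform order of consistency `q`: for all sufficiently smooth problems, the local discretization
error satisfies `max_n sup_α ‖d^{[n], s+1}‖ = O(h^q)` as `h → 0`. -/
def HasUniformConsistencyOrder (q : ℕ) : Prop :=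
  ∃ l m : ℕ, ∀ P : SmoothProblem l m, ∃ (C : ℝ) (N₀ : ℕ), ∀ N ≥ N₀, ∀ n ∈ Finset.Icc 1 N,
    M.RegularStep P N n → ∀ α ∈ Icc (0 : ℝ) 1, ‖M.residual P N n α‖ ≤ C * P.step N ^ q

/-- `(η, K, Y)` is the result of the `n`-th step when it is carried out with exact input:
`η^[n-1](θ) = y(t_{n-2} + θ)` and `K_j^[n-1] = y'(t_{n-2} + c_j h)`. -/
def IsStepFromExact {l m : ℕ} (P : SmoothProblem l m) (N n : ℕ)
    (η : C(ℝ, EuclideanSpace ℝ (Fin P.d))) (K : Fin s → EuclideanSpace ℝ (Fin P.d))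
    (Y : Fin s → C(ℝ, EuclideanSpace ℝ (Fin P.d))) : Prop :=
  M.IsStep P.r P.f (P.step N) (P.mesh N (n - 1))
    ⟨fun θ => P.y (P.mesh N (n - 2) + θ), by fun_prop⟩
    (fun j => P.exactK (P.mesh N (n - 2) + M.c j * P.step N)) η K Y

/-- Uniform order `q` (of the error of one step): for all sufficiently smooth problems and all
sufficiently small `h`, each step with exact input can be carried out, and its result `η^[n]`
satisfies `max_n sup_α ‖y(t_{n-1} + α h) - η^[n](α h)‖ = O(h^{q+1})`. -/
def HasUniformStepOrder (q : ℕ) : Prop :=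
  ∃ l m : ℕ, ∀ P : SmoothProblem l m, ∃ (C : ℝ) (N₀ : ℕ), ∀ N ≥ N₀, ∀ n ∈ Finset.Icc 1 N,
    M.RegularStep P N n →
      (∃ η K Y, M.IsStepFromExact P N n η K Y) ∧
      ∀ η K Y, M.IsStepFromExact P N n η K Y → ∀ α ∈ Icc (0 : ℝ) 1,
        ‖P.y (P.mesh N (n - 1) + α * P.step N) - η (α * P.step N)‖ ≤ C * P.step N ^ (q + 1)

end TSRK

end

/-! Subtracting the method's equations from their exact counterparts splits the error of one step
with exact input into two contributions: `h` times the residual of the exact solution, and `h • ∑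
b_j δ_j`, where `δ_j` is the error of the stage value `K_j` (`IsStepFromExact.error_eq`). Taylor
expansion turns the residual into `-∑ h^k Γ_k(α) y^(k)` up to `O(h^5)` (`norm_residual_add_le`), so
it is of the right size once `Γ_1, …, Γ_4` vanish.

For the other contribution, let `X_j` be the history error of stage `j`. Then `δ_j = A(c_j) X_j +
O(h^4)`, while `X_j` equals `h ∑ a_jk δ_k - h² Γ_j2 y'' - h³ Γ_j3 y'''` up to `O(h^4)`. The
functional `A(c_j)` depends on the stage only through its abscissa, so only sums of `X_j` over
stages with equal abscissae matter. Substituting the expansion twice, the terms below `h^4` in `∑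
b_j δ_j` carry exactly the grouped sums of `b_i Γ_i2`, `b_i Γ_i3` and `b_i a_ij Γ_j2`
(`StageErrors.exists_sum_bound`).

The hypotheses supply `Γ_4` and the last two of these sums. The remaining conditions are necessary
for order three, which is shown by test problems with solution `t^k`. If the right-hand side ignores
the history, all stage values are exact and the residual alone forces `Γ_2 = Γ_3 = 0`. For the
grouped sum of `b_i Γ_i2`, a state delay makes the right-hand side read the stage `Y^i` at `βh` when
`c_i = c_m` and at `0`, where there is no error, otherwise
(`HasUniformStepOrder.sum_mul_gammaStage_two`). In the sense of consistency the residual is all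
there is, so no condition on the stages is needed. -/

noncomputable section

/-! ### Taylor expansion of two-step quadrature formulas. -/

/-- Taylor's formula with a bound on the remainder, for a function whose successive derivatives on
a convex set are `g 1, g 2, …`. -/
lemma norm_sub_taylor_le {E : Type*} [NormedAddCommGroup E] [NormedSpace ℝ E] {S : Set ℝ}
    (hS : Convex ℝ S) {C : ℝ} (n : ℕ) : ∀ g : ℕ → ℝ → E,
    (∀ k < n, ∀ x ∈ S, HasDerivWithinAt (g k) (g (k + 1) x) S x) → (∀ x ∈ S, ‖g n x‖ ≤ C) →
    ∀ t ∈ S, ∀ x ∈ S,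
      ‖g 0 x - ∑ k ∈ Finset.range n, ((x - t) ^ k / (k.factorial : ℝ)) • g k t‖
        ≤ C * |x - t| ^ n := by
  induction n with
  | zero => intro g _ hC t _ x hx; simpa using hC x hx
  | succ n ih =>
    intro g hg hC t ht x hx
    have hC0 : 0 ≤ C := (norm_nonneg _).trans (hC t ht)
    have hsub : uIcc t x ⊆ S := by
      rw [← segment_eq_uIcc]; exact hS.segment_subset ht hx
    have key := ih (fun k => g (k + 1)) (fun k hk => hg (k + 1) (by omega)) hC t ht
    have hder : ∀ z ∈ uIcc t x, HasDerivWithinAt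
        (fun z => g 0 z - ∑ k ∈ Finset.range (n + 1), ((z - t) ^ k / (k.factorial : ℝ)) • g k t)
        (g 1 z - ∑ k ∈ Finset.range n, ((z - t) ^ k / (k.factorial : ℝ)) • g (k + 1) t)
        (uIcc t x) z := by
      intro z hz
      refine ((hg 0 (by omega) z (hsub hz)).mono hsub).sub ?_
      simp_rw [Finset.sum_range_succ' _ n]
      simp only [pow_zero, Nat.factorial_zero, Nat.cast_one, div_one, one_smul]
      refine HasDerivWithinAt.add_const _ (HasDerivWithinAt.fun_sum fun k _ => ?_)
      refine HasDerivWithinAt.smul_const ?_ _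
      have h1 : HasDerivAt (fun z : ℝ => (z - t) ^ (k + 1) / ((k + 1).factorial : ℝ))
          (((k + 1 : ℕ) : ℝ) * (z - t) ^ k * 1 / ((k + 1).factorial : ℝ)) z := by
        simpa using (((hasDerivAt_id z).sub_const t).pow (k + 1)).div_const
          ((k + 1).factorial : ℝ)
      refine h1.hasDerivWithinAt.congr_deriv ?_
      rw [Nat.factorial_succ]
      have : (k.factorial : ℝ) ≠ 0 := by positivity
      push_cast
      field_simp
    have hb : ∀ z ∈ uIcc t x,
        ‖g 1 z - ∑ k ∈ Finset.range n, ((z - t) ^ k / (k.factorial : ℝ)) • g (k + 1) t‖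
          ≤ C * |x - t| ^ n := by
      intro z hz
      refine (key z (hsub hz)).trans ?_
      have := abs_sub_left_of_mem_uIcc hz
      gcongr
    -- The remainder of `g 0` has as derivative the remainder of `g 1`, so the mean value inequality
    -- adds one factor `|x - t|`; the factorial in the sharp bound is given up.
    have := (convex_uIcc t x).norm_image_sub_le_of_norm_hasDerivWithin_le hder hb
      left_mem_uIcc right_mem_uIcc
    rw [Real.norm_eq_abs] at this
    convert this using 1
    · congr 1
      rw [Finset.sum_range_succ' _ n, Finset.sum_range_succ' _ n]
      simp
    · ring

/-- The coefficient of `-h^k y^(k)(t)` in the expansion of the residual of a two-step quadrature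
formula with weights `w`, `bt`, `b` and nodes `c`. -/
def quadDefect {s : ℕ} (c : Fin s → ℝ) (w : ℝ) (bt b : Fin s → ℝ) (α : ℝ) (k : ℕ) : ℝ :=
  1 / ((k - 1).factorial : ℝ) *
    ((1 - w) * (-1) ^ k / k + ∑ j, bt j * (-(1 - c j)) ^ (k - 1)
      + ∑ j, b j * c j ^ (k - 1) - α ^ k / k)

/-- An exact identity between polynomials in `h`, obtained by comparing powers; the constant terms
cancel because the weights `1 - w` and `w` add up to one. -/
lemma quad_taylor {E : Type*} [NormedAddCommGroup E] [NormedSpace ℝ E] {s : ℕ}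
    (c : Fin s → ℝ) (w : ℝ) (bt b : Fin s → ℝ) (α h : ℝ) (Y : ℕ → E) (n : ℕ) :
    (∑ k ∈ Finset.range (n + 1), ((α * h) ^ k / (k.factorial : ℝ)) • Y k)
      - ((1 - w) • (∑ k ∈ Finset.range (n + 1), ((-h) ^ k / (k.factorial : ℝ)) • Y k)
        + w • Y 0
        + h • ∑ j, bt j • ∑ k ∈ Finset.range n,
            ((-h + c j * h) ^ k / (k.factorial : ℝ)) • Y (k + 1)
        + h • ∑ j, b j • ∑ k ∈ Finset.range n, ((c j * h) ^ k / (k.factorial : ℝ)) • Y (k + 1))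
      = - ∑ k ∈ Finset.range n, (h ^ (k + 1) * quadDefect c w bt b α (k + 1)) • Y (k + 1) := by
  simp only [Finset.smul_sum, smul_smul]
  rw [Finset.sum_comm (s := Finset.univ), Finset.sum_comm (s := Finset.univ),
    Finset.sum_range_succ' _ n, Finset.sum_range_succ' _ n]
  simp only [← Finset.sum_smul]
  have e : ∀ a b c d v x y : E, a + v - (b + x + y + c + d) = (a - b - c - d) + (v - x - y) := by
    intros; abel
  rw [e, ← Finset.sum_sub_distrib, ← Finset.sum_sub_distrib, ← Finset.sum_sub_distrib,
    ← Finset.sum_neg_distrib]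
  have h0 : ((α * h) ^ 0 / ((Nat.factorial 0 : ℕ) : ℝ)) • Y 0
      - ((1 - w) * ((-h) ^ 0 / ((Nat.factorial 0 : ℕ) : ℝ))) • Y 0 - w • Y 0 = 0 := by
    rw [← sub_smul, ← sub_smul]; simp
  rw [h0, add_zero]
  refine Finset.sum_congr rfl fun k _ => ?_
  rw [← sub_smul, ← sub_smul, ← sub_smul, ← neg_smul]
  congr 1
  have e1 : ∑ j, h * (bt j * ((-h + c j * h) ^ k / (k.factorial : ℝ)))
      = h ^ (k + 1) / (k.factorial : ℝ) * ∑ j, bt j * (-(1 - c j)) ^ k := by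
    rw [Finset.mul_sum]
    refine Finset.sum_congr rfl fun j _ => ?_
    rw [show -h + c j * h = h * (-(1 - c j)) by ring, mul_pow]; ring
  have e2 : ∑ j, h * (b j * ((c j * h) ^ k / (k.factorial : ℝ)))
      = h ^ (k + 1) / (k.factorial : ℝ) * ∑ j, b j * c j ^ k := by
    rw [Finset.mul_sum]
    refine Finset.sum_congr rfl fun j _ => ?_
    rw [mul_pow]; ring
  rw [e1, e2, quadDefect, Nat.factorial_succ, Nat.add_sub_cancel, mul_pow, neg_pow h]
  have : (k.factorial : ℝ) ≠ 0 := by positivity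
  push_cast
  field_simp
  ring

lemma norm_smul_sum_smul_le {E : Type*} [NormedAddCommGroup E] [NormedSpace ℝ E] {s : ℕ}
    {b : Fin s → ℝ} {z : Fin s → E} {h B D : ℝ} (hh : 0 ≤ h) (hb : ∀ j, |b j| ≤ B)
    (hz : ∀ j, ‖z j‖ ≤ D) : ‖h • ∑ j, b j • z j‖ ≤ h * (s * (B * D)) := by
  rw [norm_smul, Real.norm_of_nonneg hh]
  gcongr
  refine (norm_sum_le _ _).trans ?_
  refine (Finset.sum_le_sum (g := fun _ => B * D) fun j _ => ?_).trans (by simp)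
  rw [norm_smul, Real.norm_eq_abs]
  exact mul_le_mul (hb j) (hz j) (norm_nonneg _) ((abs_nonneg _).trans (hb j))

/-- Expansion of the residual of a two-step quadrature formula. -/
lemma norm_quad_sub_le {E : Type*} [NormedAddCommGroup E] [NormedSpace ℝ E] {s : ℕ}
    {c : Fin s → ℝ} {w : ℝ} {bt b : Fin s → ℝ} {α h R B C : ℝ} {Y : ℕ → E} {y z : ℝ → E} {n : ℕ}
    (hh : 0 ≤ h) (hR : 1 ≤ R) (hC : 0 ≤ C) (hα : α ∈ Icc 0 R) (hc : ∀ j, c j ∈ Icc 0 R)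
    (hw : |w| ≤ B) (hbt : ∀ j, |bt j| ≤ B) (hb : ∀ j, |b j| ≤ B) (hy0 : y 0 = Y 0)
    (hy : ∀ x ∈ Icc (-h) (R * h),
      ‖y x - ∑ k ∈ Finset.range (n + 1), (x ^ k / (k.factorial : ℝ)) • Y k‖ ≤ C * |x| ^ (n + 1))
    (hz : ∀ x ∈ Icc (-h) (R * h),
      ‖z x - ∑ k ∈ Finset.range n, (x ^ k / (k.factorial : ℝ)) • Y (k + 1)‖ ≤ C * |x| ^ n) :
    ‖y (α * h) - ((1 - w) • y (-h) + w • y 0 + h • ∑ j, bt j • z (-h + c j * h)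
        + h • ∑ j, b j • z (c j * h))
      + ∑ k ∈ Finset.range n, (h ^ (k + 1) * quadDefect c w bt b α (k + 1)) • Y (k + 1)‖
      ≤ (2 + B + 2 * s * B) * C * R ^ (n + 1) * h ^ (n + 1) := by
  have hB : 0 ≤ B := (abs_nonneg _).trans hw
  have hRh : h ≤ R * h := le_mul_of_one_le_left hh hR
  have hmem1 : ∀ a ∈ Icc 0 R, a * h ∈ Icc (-h) (R * h) := fun a ha =>
    ⟨by have := mul_nonneg ha.1 hh; linarith, mul_le_mul_of_nonneg_right ha.2 hh⟩
  have hmem2 : ∀ a ∈ Icc 0 R, -h + a * h ∈ Icc (-h) (R * h) := fun a ha =>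
    ⟨by have := mul_nonneg ha.1 hh; linarith,
      by have := mul_le_mul_of_nonneg_right ha.2 hh; linarith⟩
  have habs : ∀ x ∈ Icc (-h) (R * h), |x| ≤ R * h := fun x hx =>
    abs_le.2 ⟨by linarith [hx.1], hx.2⟩
  set D := C * (R * h) ^ n with hD
  have hz' : ∀ x ∈ Icc (-h) (R * h),
      ‖z x - ∑ k ∈ Finset.range n, (x ^ k / (k.factorial : ℝ)) • Y (k + 1)‖ ≤ D := fun x hx =>
    (hz x hx).trans (by have := habs x hx; rw [hD]; gcongr)
  have hy' : ∀ x ∈ Icc (-h) (R * h),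
      ‖y x - ∑ k ∈ Finset.range (n + 1), (x ^ k / (k.factorial : ℝ)) • Y k‖
        ≤ D * (R * h) := fun x hx =>
    (hy x hx).trans (by have := habs x hx; rw [hD, mul_assoc, ← pow_succ]; gcongr)
  have hD0 : 0 ≤ D := by positivity
  have T1 := hy' _ (hmem1 α hα)
  have T2 : ‖(1 - w) • (y (-h)
      - ∑ k ∈ Finset.range (n + 1), ((-h) ^ k / (k.factorial : ℝ)) • Y k)‖
      ≤ (1 + B) * (D * (R * h)) := by
    rw [norm_smul]
    refine mul_le_mul ?_ (hy' _ ⟨le_rfl, by linarith⟩) (norm_nonneg _) (by positivity)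
    refine (norm_sub_le _ _).trans ?_
    simpa using hw
  have T3 := norm_smul_sum_smul_le hh hbt fun j => hz' _ (hmem2 _ (hc j))
  have T4 := norm_smul_sum_smul_le hh hb fun j => hz' _ (hmem1 _ (hc j))
  -- With Taylor polynomials in place of `y` and `z` the formula is exact, so the four remainders
  -- `T1` to `T4` account for the whole error.
  have key := quad_taylor c w bt b α h Y n
  simp only [smul_sub, Finset.sum_sub_distrib] at T2 T3 T4
  have hx : ∀ {a b c d a' b' c' d' v q : E}, a' - (b' + v + c' + d') = - q →
      a - (b + v + c + d) + q = (a - a') - (b - b') - (c - c') - (d - d') := by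
    intro a b c d a' b' c' d' v q hq
    rw [← neg_eq_iff_eq_neg] at hq
    rw [← hq]; abel
  rw [hy0, hx key]
  have hfin : D * (R * h) + (1 + B) * (D * (R * h)) + h * (s * (B * D)) + h * (s * (B * D))
      ≤ (2 + B + 2 * s * B) * C * R ^ (n + 1) * h ^ (n + 1) := by
    have e : (2 + B + 2 * s * B) * C * R ^ (n + 1) * h ^ (n + 1)
        = (2 + B + 2 * s * B) * (D * (R * h)) := by rw [hD]; ring
    rw [e]
    have : h * (s * (B * D)) ≤ R * h * (s * (B * D)) := by gcongr
    nlinarith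
  refine le_trans ?_ hfin
  refine (norm_sub_le _ _).trans (add_le_add ?_ T4)
  refine (norm_sub_le _ _).trans (add_le_add ?_ T3)
  exact (norm_sub_le _ _).trans (add_le_add T1 T2)

/-! ### Uniform expansions of the right-hand side and of the exact solution. -/

/-- First-order Taylor expansion in a ball where the second derivative is bounded. -/
lemma norm_sub_sub_fderiv_le {F E : Type*} [NormedAddCommGroup F] [NormedSpace ℝ F]
    [NormedAddCommGroup E] [NormedSpace ℝ E] {f : F → E} (hcd : ContDiff ℝ 2 f) {ψ φ : F}
    {C ρ : ℝ} (hC : 0 ≤ C) (H : ∀ χ, dist χ ψ < ρ → ‖iteratedFDeriv ℝ 2 f χ‖ ≤ C)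
    (hφ : ‖φ - ψ‖ < ρ) :
    ‖f φ - f ψ - fderiv ℝ f ψ (φ - ψ)‖ ≤ C * ‖φ - ψ‖ ^ 2 := by
  have hρ : 0 < ρ := (norm_nonneg _).trans_lt hφ
  have hdd : Differentiable ℝ (fderiv ℝ f) :=
    (hcd.fderiv_right (m := 1) (by norm_num)).differentiable (by norm_num)
  have hball : ∀ χ ∈ Metric.ball ψ ρ, ‖fderiv ℝ (fderiv ℝ f) χ‖ ≤ C := by
    intro χ hχ
    refine le_trans (le_of_eq ?_) (H χ hχ)
    rw [← norm_iteratedFDeriv_fderiv, ← norm_iteratedFDeriv_fderiv, norm_iteratedFDeriv_zero]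
  have hlip : ∀ χ ∈ segment ℝ ψ φ, ‖fderiv ℝ f χ - fderiv ℝ f ψ‖ ≤ C * ‖φ - ψ‖ := by
    intro χ hχ
    have hin : ‖χ - ψ‖ ≤ ‖φ - ψ‖ := by
      obtain ⟨a, b, ha, hb, hab, rfl⟩ := hχ
      have : a • ψ + b • φ - ψ = b • (φ - ψ) := by
        rw [show a = 1 - b by linarith]; module
      rw [this, norm_smul, Real.norm_of_nonneg hb]
      exact mul_le_of_le_one_left (norm_nonneg _) (by linarith)
    have := (convex_ball ψ ρ).norm_image_sub_le_of_norm_fderiv_le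
      (f := fderiv ℝ f) (fun x _ => hdd x) hball (Metric.mem_ball_self hρ)
      (y := χ) (by rw [mem_ball_iff_norm]; exact hin.trans_lt hφ)
    exact this.trans (by gcongr)
  have := (convex_segment ψ φ).norm_image_sub_le_of_norm_hasFDerivWithin_le'
    (f := f) (f' := fderiv ℝ f) (φ := fderiv ℝ f ψ)
    (fun x _ => (hcd.differentiable (by norm_num) x).hasFDerivAt.hasFDerivWithinAt) hlip
    (left_mem_segment ℝ ψ φ) (right_mem_segment ℝ ψ φ)
  refine this.trans_eq ?_
  ring

namespace SmoothProblem

variable {l m : ℕ} (P : SmoothProblem l m)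

/-- The derivatives of the exact solution, uniformly bounded over all intervals without break
points. -/
lemma exists_derivs_bound {n : ℕ} (hn : n ≤ m) : ∃ C : ℝ, 0 ≤ C ∧ ∀ p q : ℝ, P.σ ≤ p → p < q →
    q ≤ P.τ → (∀ x ∈ P.breaks, x ∉ Ioo p q) →
    ∃ g : ℕ → ℝ → EuclideanSpace ℝ (Fin P.d), g 0 = P.y ∧
      (∀ k < n, ∀ x ∈ Icc p q, HasDerivWithinAt (g k) (g (k + 1) x) (Icc p q) x) ∧
      ∀ k ≤ n, ∀ x ∈ Icc p q, ‖g k x‖ ≤ C := by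
  have hb : ∀ z : ℝ × ℝ, ∃ C : ℝ, P.σ ≤ z.1 → z.1 < z.2 → z.2 ≤ P.τ →
      (∀ x ∈ P.breaks, x ∉ Ioo z.1 z.2) → ∀ k ≤ n, ∀ x ∈ Icc z.1 z.2,
        ‖iteratedDerivWithin k P.y (Icc z.1 z.2) x‖ ≤ C := by
    intro z
    by_cases H : P.σ ≤ z.1 ∧ z.1 < z.2 ∧ z.2 ≤ P.τ ∧ ∀ x ∈ P.breaks, x ∉ Ioo z.1 z.2
    · obtain ⟨h1, h2, h3, h4⟩ := H
      have hcd := P.piecewise _ _ h1 h2 h3 h4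
      have : ∀ k : ℕ, ∃ C : ℝ, k ≤ n → ∀ x ∈ Icc z.1 z.2,
          ‖iteratedDerivWithin k P.y (Icc z.1 z.2) x‖ ≤ C := by
        intro k
        by_cases hk : k ≤ n
        · obtain ⟨C, hC⟩ := isCompact_Icc.exists_bound_of_continuousOn
            (hcd.continuousOn_iteratedDerivWithin (m := k) (by exact_mod_cast hk.trans hn)
              (uniqueDiffOn_Icc h2))
          exact ⟨C, fun _ => hC⟩
        · exact ⟨0, fun h => absurd h hk⟩
      choose C hC using this
      refine ⟨∑ k ∈ Finset.range (n + 1), |C k|, fun _ _ _ _ k hk x hx => ?_⟩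
      refine (hC k hk x hx).trans ((le_abs_self _).trans ?_)
      exact Finset.single_le_sum (f := fun k => |C k|) (fun _ _ => abs_nonneg _)
        (Finset.mem_range.2 (by omega))
    · exact ⟨0, fun h1 h2 h3 h4 => absurd ⟨h1, h2, h3, h4⟩ H⟩
  choose C hC using hb
  -- Every interval without break points lies in a maximal one with endpoints in the finite set `F`.
  -- Summing the bounds over all pairs from `F` makes the constant independent of `p` and `q`.
  let F : Finset ℝ := insert P.σ (insert P.τ P.breaks)
  refine ⟨∑ z ∈ F ×ˢ F, |C z|, Finset.sum_nonneg fun _ _ => abs_nonneg _, ?_⟩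
  intro p q hp hpq hq hbr
  obtain ⟨p', hp'F, hp'⟩ := (F.filter (· ≤ p)).exists_max_image id ⟨P.σ, by simp [F, hp]⟩
  obtain ⟨q', hq'F, hq'⟩ := (F.filter (q ≤ ·)).exists_min_image id ⟨P.τ, by simp [F, hq]⟩
  rw [Finset.mem_filter] at hp'F hq'F
  simp only [id, Finset.mem_filter, and_imp] at hp' hq'
  have h1 : P.σ ≤ p' := hp' _ (by simp [F]) hp
  have h2 : p' < q' := hp'F.2.trans_lt (hpq.trans_le hq'F.2)
  have h3 : q' ≤ P.τ := hq' _ (by simp [F]) hq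
  have h4 : ∀ x ∈ P.breaks, x ∉ Ioo p' q' := by
    intro x hx hx'
    have hxF : x ∈ F := by simp [F, hx]
    refine hbr x hx ⟨?_, ?_⟩
    · by_contra! hle
      exact absurd (hp' x hxF hle) (not_le.2 hx'.1)
    · by_contra! hle
      exact absurd (hq' x hxF hle) (not_le.2 hx'.2)
  have hcd := P.piecewise _ _ h1 h2 h3 h4
  have hsub : Icc p q ⊆ Icc p' q' := Icc_subset_Icc hp'F.2 hq'F.2
  -- The derivatives are taken within the maximal interval, where they are bounded, and then
  -- restricted.
  refine ⟨fun k => iteratedDerivWithin k P.y (Icc p' q'), by simp, fun k hk x hx => ?_,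
    fun k hk x hx => ?_⟩
  · simp only [iteratedDerivWithin_succ]
    exact ((hcd.differentiableOn_iteratedDerivWithin (m := k)
      (by exact_mod_cast hk.trans_le hn) (uniqueDiffOn_Icc h2)) x
        (hsub hx)).hasDerivWithinAt.mono hsub
  · refine (hC (p', q') h1 h2 h3 h4 k hk x (hsub hx)).trans ((le_abs_self _).trans ?_)
    exact Finset.single_le_sum (f := fun z => |C z|) (fun _ _ => abs_nonneg _)
      (Finset.mem_product.2 ⟨hp'F.1, hq'F.1⟩)

/-- The Taylor expansions of the exact solution and of its derivative. -/
lemma exists_taylor_bound {n : ℕ} (hn : n + 1 ≤ m) : ∃ C : ℝ, 0 ≤ C ∧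
    ∀ p q : ℝ, P.σ ≤ p → p < q → q ≤ P.τ → (∀ x ∈ P.breaks, x ∉ Ioo p q) → ∀ t ∈ Icc p q,
    ∃ Y : ℕ → EuclideanSpace ℝ (Fin P.d), Y 0 = P.y t ∧ (∀ k ≤ n + 1, ‖Y k‖ ≤ C) ∧
      ∀ x, t + x ∈ Icc p q →
        ‖P.y (t + x) - ∑ k ∈ Finset.range (n + 1), (x ^ k / (k.factorial : ℝ)) • Y k‖
          ≤ C * |x| ^ (n + 1) ∧
        ‖P.exactK (t + x) - ∑ k ∈ Finset.range n, (x ^ k / (k.factorial : ℝ)) • Y (k + 1)‖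
          ≤ C * |x| ^ n := by
  obtain ⟨C, hC0, hC⟩ := P.exists_derivs_bound hn
  refine ⟨C, hC0, fun p q hp hpq hq hbr t ht => ?_⟩
  obtain ⟨g, hg0, hg, hgC⟩ := hC p q hp hpq hq hbr
  refine ⟨fun k => g k t, by simp [hg0], fun k hk => hgC k hk t ht, fun x hx => ⟨?_, ?_⟩⟩
  · have := norm_sub_taylor_le (convex_Icc p q) (n + 1) g hg (hgC _ le_rfl) t ht _ hx
    simpa [hg0] using this
  · have := norm_sub_taylor_le (convex_Icc p q) n (fun k => g (k + 1))
      (fun k hk => hg (k + 1) (by omega)) (hgC _ le_rfl) t ht _ hx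
    have hsub : Icc p q ⊆ Icc P.σ P.τ := Icc_subset_Icc hp hq
    have h1 := hg 0 (by omega) _ hx
    rw [hg0] at h1
    have h2 := (P.solution _ (hsub hx)).mono hsub
    have h3 : g 1 (t + x) = P.exactK (t + x) :=
      (uniqueDiffOn_Icc hpq _ hx).eq_deriv _ h1 h2
    simpa [h3] using this

lemma continuous_shift {E : Type} [NormedAddCommGroup E] (r : ℝ) (u : C(ℝ, E)) :
    Continuous (shift r u) := by
  apply ContinuousMap.continuous_of_continuous_uncurry
  change Continuous fun p : ℝ × Icc (-r) (0 : ℝ) => u (p.1 + p.2)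
  fun_prop

/-- The right-hand side is differentiable along the exact solution, with a uniform quadratic
remainder. -/
lemma exists_fderiv_remainder_bound (hl : 2 ≤ l) : ∃ C ρ : ℝ, 0 ≤ C ∧ 0 < ρ ∧
    ∀ t ∈ Icc P.σ P.τ, ∀ φ, ‖φ - shift P.r P.y t‖ < ρ →
      ‖P.f t φ - P.f t (shift P.r P.y t)
        - fderiv ℝ (P.f t) (shift P.r P.y t) (φ - shift P.r P.y t)‖
        ≤ C * ‖φ - shift P.r P.y t‖ ^ 2 := by
  have key : ∃ C ρ : ℝ, 0 < ρ ∧ ∀ t ∈ Icc P.σ P.τ, ∀ φ, dist φ (shift P.r P.y t) < ρ →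
      ‖iteratedFDeriv ℝ 2 (P.f t) φ‖ ≤ C := by
    -- The local bounds around the points `(t, y_t)` are joined by compactness to one bound on a
    -- tube around the solution curve.
    refine isCompact_Icc.induction_on (p := fun S => ∃ C ρ : ℝ, 0 < ρ ∧ ∀ t ∈ S, ∀ φ,
      dist φ (shift P.r P.y t) < ρ → ‖iteratedFDeriv ℝ 2 (P.f t) φ‖ ≤ C) ?_ ?_ ?_ ?_
    · exact ⟨0, 1, one_pos, by simp⟩
    · rintro S S' hSS ⟨C, ρ, hρ, H⟩
      exact ⟨C, ρ, hρ, fun t ht => H t (hSS ht)⟩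
    · rintro S S' ⟨C, ρ, hρ, H⟩ ⟨C', ρ', hρ', H'⟩
      refine ⟨max C C', min ρ ρ', lt_min hρ hρ', ?_⟩
      rintro t (ht | ht) φ hφ
      · exact (H t ht φ (hφ.trans_le (min_le_left _ _))).trans (le_max_left _ _)
      · exact (H' t ht φ (hφ.trans_le (min_le_right _ _))).trans (le_max_right _ _)
    · intro t _
      obtain ⟨C, hC⟩ := P.rhs.locally_bounded 2 hl t (shift P.r P.y t)
      obtain ⟨ε, hε, H⟩ := Metric.eventually_nhds_iff.1 hC
      have h1 : ∀ᶠ t' in 𝓝 t, dist (shift P.r P.y t') (shift P.r P.y t) < ε / 2 :=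
        (continuous_shift P.r P.y).continuousAt.eventually (Metric.ball_mem_nhds _ (half_pos hε))
      have h2 : ∀ᶠ t' in 𝓝 t, dist t' t < ε := Metric.ball_mem_nhds _ hε
      refine ⟨_, mem_nhdsWithin_of_mem_nhds (h1.and h2), C, ε / 2, half_pos hε, ?_⟩
      rintro t' ⟨ht1, ht2⟩ φ hφ
      refine H (y := (t', φ)) ?_
      rw [Prod.dist_eq]
      refine max_lt ht2 ((dist_triangle _ _ _).trans_lt (add_lt_add hφ ht1 |>.trans_eq ?_))
      ring
  obtain ⟨C, ρ, hρ, H⟩ := key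
  refine ⟨max C 0, ρ, le_max_right _ _, hρ, fun t ht φ hφ => ?_⟩
  exact norm_sub_sub_fderiv_le ((P.rhs.contDiff t).of_le (by exact_mod_cast hl))
    (le_max_right _ _) (fun χ hχ => (H t ht χ hχ).trans (le_max_left _ _)) hφ

end SmoothProblem

/-! ### Propagation of errors through the stages. -/

namespace TSRK

variable {s : ℕ} (M : TSRK s)

/-- A common bound for all coefficients of the method. -/
structure CoeffBound (B : ℝ) : Prop where
  u : ∀ i, ∀ α ∈ Icc 0 (M.c i), |(M.u i).eval α| ≤ B
  a : ∀ i j, ∀ α ∈ Icc 0 (M.c i), |(M.a i j).eval α| ≤ B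
  aT : ∀ i j, ∀ α ∈ Icc 0 (M.c i), |(M.aT i j).eval α| ≤ B
  v : ∀ α ∈ Icc (0 : ℝ) 1, |M.v.eval α| ≤ B
  b : ∀ j, ∀ α ∈ Icc (0 : ℝ) 1, |(M.b j).eval α| ≤ B
  bT : ∀ j, ∀ α ∈ Icc (0 : ℝ) 1, |(M.bT j).eval α| ≤ B
  -- Only `k = 2, 3, 4` are needed.
  gammaStage : ∀ i, ∀ k : Fin 5, ∀ α ∈ Icc 0 (M.c i), |M.gammaStage i k α| ≤ B

lemma exists_coeffBound : ∃ B, 0 ≤ B ∧ M.CoeffBound B := by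
  have key : ∀ (f : ℝ → ℝ), Continuous f → ∀ x : ℝ,
      ∀ᶠ B in atTop, ∀ α ∈ Icc 0 x, |f α| ≤ B := by
    intro f hf x
    obtain ⟨C, hC⟩ := (isCompact_Icc (a := (0 : ℝ)) (b := x)).exists_bound_of_continuousOn
      hf.continuousOn
    filter_upwards [eventually_ge_atTop C] with B hB α hα using (hC α hα).trans hB
  have hg : ∀ i k, Continuous (M.gammaStage i k) := by
    intro i k
    unfold TSRK.gammaStage
    fun_prop
  obtain ⟨B, h0, h1, h2, h3, h4, h5, h6, h7⟩ := ((eventually_ge_atTop (0 : ℝ)).and <|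
    (eventually_all.2 fun i => key _ (M.u i).continuous (M.c i)).and <|
    (eventually_all.2 fun i => eventually_all.2 fun j =>
      key _ (M.a i j).continuous (M.c i)).and <|
    (eventually_all.2 fun i => eventually_all.2 fun j =>
      key _ (M.aT i j).continuous (M.c i)).and <|
    (key _ M.v.continuous 1).and <|
    (eventually_all.2 fun j => key _ (M.b j).continuous 1).and <|
    (eventually_all.2 fun j => key _ (M.bT j).continuous 1).and <|
    (eventually_all.2 fun i => eventually_all.2 fun k : Fin 5 =>
      key _ (hg i k) (M.c i))).exists
  exact ⟨B, h0, h1, h2, h3, h4, h5, h6, h7⟩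

lemma c_le_reach (i : Fin s) : M.c i ≤ M.reach :=
  (le_ciSup (f := M.c) (Set.finite_range _).bddAbove i).trans (le_max_right _ _)

lemma one_le_reach : 1 ≤ M.reach := le_max_left _ _

lemma gammaStage_eq_quadDefect (i : Fin s) (k : ℕ) (α : ℝ) :
    M.gammaStage i k α = quadDefect M.c ((M.u i).eval α) (fun j => (M.aT i j).eval α)
      (fun j => (M.a i j).eval α) α k := rfl

lemma gamma_eq_quadDefect (k : ℕ) (α : ℝ) :
    M.gamma k α = quadDefect M.c (M.v.eval α) (fun j => (M.bT j).eval α)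
      (fun j => (M.b j).eval α) α k := rfl

variable {M}

lemma StageOrderOne.gamma_one (H : M.StageOrderOne) {α : ℝ} (hα : α ∈ Icc (0 : ℝ) 1) :
    M.gamma 1 α = 0 := by
  have := H.1 α hα
  simp [gamma]
  linarith

lemma StageOrderOne.gammaStage_one (H : M.StageOrderOne) {i : Fin s} {α : ℝ}
    (hα : α ∈ Icc 0 (M.c i)) : M.gammaStage i 1 α = 0 := by
  have := H.2 i α hα
  simp [gammaStage]
  linarith

lemma gammaStage_zero_right (i : Fin s) {k : ℕ} (hk : k ≠ 0) : M.gammaStage i k 0 = 0 := by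
  simp [gammaStage, M.u_zero, M.a_zero, M.aT_zero, hk]

/-- The relations between the errors `X j` of the stages `Y^{[n] j}` and the errors `δ j` of the
stage values `K_j^{[n]}`, in one step with exact input.  The linear functional `A x` is the
derivative of the right-hand side at the time `t_{n-1} + x h`, and `Y2`, `Y3` are the second and
third derivative of the exact solution. -/
structure StageErrors (M : TSRK s) {r : ℝ} {E : Type} [NormedAddCommGroup E] [NormedSpace ℝ E]
    (B L C ρ h : ℝ) (Y2 Y3 : E) (A : ℝ → Hist r E →L[ℝ] E) (δ : Fin s → E)
    (X : Fin s → Hist r E) : Prop where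
  Y2_le : ‖Y2‖ ≤ C
  Y3_le : ‖Y3‖ ≤ C
  A_le : ∀ x, ‖A x‖ ≤ L
  δ_le : ∀ j, ‖δ j‖ ≤ L * ‖X j‖
  δ_sub_le : ∀ j, ‖X j‖ < ρ → ‖δ j - A (M.c j) (X j)‖ ≤ C * ‖X j‖ ^ 2
  -- The history at `c_j h`, shifted by `θ`, is evaluated at `(c_j + θ / h) h`. If this is negative,
  -- both functions are the exact past; the cut-off at `0` fits, since `a_jk`, `Γ_j2` and `Γ_j3`
  -- vanish there.
  X_sub_le : ∀ j θ, ‖X j θ - h • ∑ k, (M.a j k).eval (max 0 (M.c j + θ / h)) • δ k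
    + (h ^ 2 * M.gammaStage j 2 (max 0 (M.c j + θ / h))) • Y2
    + (h ^ 3 * M.gammaStage j 3 (max 0 (M.c j + θ / h))) • Y3‖ ≤ C * h ^ 4

variable {r : ℝ} {E : Type} [NormedAddCommGroup E] [NormedSpace ℝ E] {B L C ρ h : ℝ}
  {Y2 Y3 : E} {A : ℝ → Hist r E →L[ℝ] E} {δ : Fin s → E} {X : Fin s → Hist r E}

lemma max_zero_mem_Icc (hh : 0 < h) (j : Fin s) (θ : Icc (-r) (0 : ℝ)) :
    max 0 (M.c j + θ / h) ∈ Icc 0 (M.c j) :=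
  ⟨le_max_left _ _, max_le (M.c_nonneg j)
    (by have := div_nonpos_of_nonpos_of_nonneg θ.2.2 hh.le; linarith)⟩

variable (r E)

/-- The errors of the stages are `O(h²)`. -/
lemma StageErrors.exists_bound (hM : M.CoeffBound B) (hB : 0 ≤ B) (hL : 0 ≤ L) (hC : 0 ≤ C)
    (hρ : 0 < ρ) : ∃ D : ℝ, 0 ≤ D ∧ ∀ᶠ h in 𝓝[>] (0 : ℝ), ∀ (Y2 Y3 : E)
      (A : ℝ → Hist r E →L[ℝ] E) (δ : Fin s → E) (X : Fin s → Hist r E),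
      M.StageErrors B L C ρ h Y2 Y3 A δ X →
      ∀ j, ‖X j‖ ≤ D * h ^ 2 ∧ ‖δ j‖ ≤ D * h ^ 2 ∧ ‖δ j - A (M.c j) (X j)‖ ≤ D * h ^ 4 := by
  set C1 := 2 * B * C + C with hC1
  have hC10 : 0 ≤ C1 := by positivity
  set D := 2 * s * C1
  have hD0 : 0 ≤ D := by positivity
  refine ⟨max D (max (L * D) (C * D ^ 2)), hD0.trans (le_max_left _ _), ?_⟩
  -- Summing the bounds on `‖X j‖` gives `Ξ ≤ s C1 h² + s² B L h Ξ`. For small `h` the last term is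
  -- at most `Ξ / 2` and is absorbed, whence `D = 2 s C1`.
  have ev1 : ∀ᶠ h in 𝓝[>] (0 : ℝ), s * (s * (B * L)) * h < 1 / 2 := by
    refine nhdsWithin_le_nhds (ContinuousAt.eventually_lt (by fun_prop) (by fun_prop) ?_)
    norm_num
  have ev2 : ∀ᶠ h in 𝓝[>] (0 : ℝ), D * h ^ 2 < ρ := by
    refine nhdsWithin_le_nhds (ContinuousAt.eventually_lt (by fun_prop) (by fun_prop) ?_)
    simpa using hρ
  have ev3 : ∀ᶠ h in 𝓝[>] (0 : ℝ), h < 1 :=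
    nhdsWithin_le_nhds (gt_mem_nhds one_pos)
  filter_upwards [ev1, ev2, ev3, self_mem_nhdsWithin] with h h1 h2 h3 hh Y2 Y3 A δ X H
  replace hh : 0 < h := hh
  set Ξ := ∑ j, ‖X j‖
  have hΞ0 : 0 ≤ Ξ := Finset.sum_nonneg fun _ _ => norm_nonneg _
  have hΞ : ∀ j, ‖X j‖ ≤ Ξ := fun j =>
    Finset.single_le_sum (f := fun j => ‖X j‖) (fun _ _ => norm_nonneg _) (Finset.mem_univ j)
  have hX : ∀ j, ‖X j‖ ≤ C1 * h ^ 2 + h * (s * (B * (L * Ξ))) := by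
    intro j
    refine (ContinuousMap.norm_le _ (by positivity)).2 fun θ => ?_
    have hβ := max_zero_mem_Icc (M := M) hh j θ
    have e0 := H.X_sub_le j θ
    set β := max 0 (M.c j + θ / h)
    have e1 : ‖h • ∑ k, (M.a j k).eval β • δ k‖ ≤ h * (s * (B * (L * Ξ))) :=
      norm_smul_sum_smul_le hh.le (fun k => hM.a j k β hβ)
        fun k => (H.δ_le k).trans (by have := hΞ k; gcongr)
    have e2 : ‖(h ^ 2 * M.gammaStage j 2 β) • Y2‖ ≤ h ^ 2 * B * C := by
      rw [norm_smul, norm_mul, Real.norm_eq_abs, Real.norm_eq_abs, abs_of_pos (by positivity)]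
      have := hM.gammaStage j 2 β hβ
      have := H.Y2_le
      gcongr
      assumption
    have e3 : ‖(h ^ 3 * M.gammaStage j 3 β) • Y3‖ ≤ h ^ 2 * B * C := by
      rw [norm_smul, norm_mul, Real.norm_eq_abs, Real.norm_eq_abs, abs_of_pos (by positivity)]
      have := hM.gammaStage j 3 β hβ
      have := H.Y3_le
      have : h ^ 3 ≤ h ^ 2 := pow_le_pow_of_le_one hh.le h3.le (by norm_num)
      gcongr
      assumption
    have e4 : C * h ^ 4 ≤ C * h ^ 2 := by
      gcongr C * ?_
      exact pow_le_pow_of_le_one hh.le h3.le (by norm_num)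
    have e5 : ∀ x a b c : E, x = (x - a + b + c) + a - b - c := by intros; abel
    rw [e5 (X j θ) (h • ∑ k, (M.a j k).eval β • δ k) ((h ^ 2 * M.gammaStage j 2 β) • Y2)
      ((h ^ 3 * M.gammaStage j 3 β) • Y3)]
    refine (norm_sub_le _ _).trans ?_
    refine (add_le_add ((norm_sub_le _ _).trans (add_le_add ((norm_add_le _ _).trans
      (add_le_add (e0.trans e4) e1)) e2)) e3).trans (le_of_eq ?_)
    rw [hC1]; ring
  have hΞle : Ξ ≤ D * h ^ 2 := by
    have : Ξ ≤ s * (C1 * h ^ 2 + h * (s * (B * (L * Ξ)))) :=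
      (Finset.sum_le_sum fun j _ => hX j).trans (by
        rw [Finset.sum_const, nsmul_eq_mul, Finset.card_univ, Fintype.card_fin])
    have h4 : s * (s * (B * L)) * h * Ξ ≤ 1 / 2 * Ξ := by gcongr
    simp only [D]
    nlinarith
  intro j
  have hj := (hΞ j).trans hΞle
  refine ⟨hj.trans ?_, (H.δ_le j).trans ?_, (H.δ_sub_le j (hj.trans_lt h2)).trans ?_⟩
  · gcongr; exact le_max_left _ _
  · calc L * ‖X j‖ ≤ L * D * h ^ 2 := by rw [mul_assoc]; gcongr
      _ ≤ _ := by gcongr; exact (le_max_left _ _).trans (le_max_right _ _)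
  · calc C * ‖X j‖ ^ 2 ≤ C * (D * h ^ 2) ^ 2 := by gcongr
      _ = C * D ^ 2 * h ^ 4 := by ring
      _ ≤ _ := by gcongr; exact (le_max_right _ _).trans (le_max_right _ _)

variable {r E}

lemma norm_sum_filter_le {F : Type*} [SeminormedAddCommGroup F] {D : ℝ} (hD : 0 ≤ D)
    (p : Fin s → Prop) [DecidablePred p] {x : Fin s → F} (hx : ∀ j, p j → ‖x j‖ ≤ D) :
    ‖∑ j with p j, x j‖ ≤ s * D := by
  refine (norm_sum_le_of_le _ fun j hj => hx j (Finset.mem_filter.1 hj).2).trans ?_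
  rw [Finset.sum_const, nsmul_eq_mul]
  gcongr
  exact_mod_cast (Finset.card_le_univ _).trans (by simp)

/-- A weighted sum of stage value errors, in terms of the sums over stages with equal abscissae. -/
lemma StageErrors.norm_sum_smul_le (H : M.StageErrors B L C ρ h Y2 Y3 A δ X) (hL : 0 ≤ L)
    {D : ℝ} (hδ : ∀ j, ‖δ j - A (M.c j) (X j)‖ ≤ D) {w : Fin s → ℝ} {W κ : ℝ}
    (hw : ∀ j, |w j| ≤ W) (hκ : 0 ≤ κ)
    (hX : ∀ m, ‖∑ j with M.c j = M.c m, w j • X j‖ ≤ κ) :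
    ‖∑ j, w j • δ j‖ ≤ s * (W * D) + s * (L * κ) := by
  have e : ∑ j, w j • δ j
      = ∑ j, w j • (δ j - A (M.c j) (X j)) + ∑ j, w j • A (M.c j) (X j) := by
    rw [← Finset.sum_add_distrib]
    exact Finset.sum_congr rfl fun j _ => by rw [← smul_add, sub_add_cancel]
  rw [e]
  refine (norm_add_le _ _).trans (add_le_add ?_ ?_)
  · simpa using norm_smul_sum_smul_le zero_le_one hw hδ
  · have hmaps : ∀ j ∈ (Finset.univ : Finset (Fin s)), M.c j ∈ Finset.univ.image M.c :=
      fun j _ => Finset.mem_image_of_mem _ (Finset.mem_univ j)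
    rw [← Finset.sum_fiberwise_of_maps_to hmaps]
    refine (norm_sum_le_of_le _ (n := fun _ => L * κ) fun x hx => ?_).trans ?_
    · obtain ⟨m, -, rfl⟩ := Finset.mem_image.1 hx
      -- Stages with equal abscissae share one linear functional, which can therefore be taken out
      -- of the sum.
      have : ∑ j with M.c j = M.c m, w j • A (M.c j) (X j)
          = A (M.c m) (∑ j with M.c j = M.c m, w j • X j) := by
        rw [map_sum]
        refine Finset.sum_congr rfl fun j hj => ?_
        rw [(Finset.mem_filter.1 hj).2, map_smul]
      rw [this]
      refine ((A (M.c m)).le_opNorm _).trans ?_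
      have := H.A_le (M.c m)
      have := hX m
      gcongr
    · rw [Finset.sum_const, nsmul_eq_mul]
      gcongr
      exact_mod_cast Finset.card_image_le.trans (by simp)

/-- Sums of stage errors over stages with equal abscissae. -/
lemma StageErrors.norm_sum_filter_smul_le (H : M.StageErrors B L C ρ h Y2 Y3 A δ X)
    (hC : 0 ≤ C) (hh : 0 < h)
    {w : Fin s → ℝ} {W κ κ' : ℝ} (hW : 0 ≤ W) (hw : ∀ j, |w j| ≤ W) (m : Fin s) (hκ : 0 ≤ κ)
    (hκ' : 0 ≤ κ')
    (h2 : ∀ β ∈ Icc 0 (M.c m), ∑ j with M.c j = M.c m, w j * M.gammaStage j 2 β = 0)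
    (h3 : ∀ β ∈ Icc 0 (M.c m), ‖∑ j with M.c j = M.c m, (w j * M.gammaStage j 3 β) • Y3‖ ≤ κ)
    (ha : ∀ β ∈ Icc 0 (M.c m),
      ‖∑ k, (∑ j with M.c j = M.c m, w j * (M.a j k).eval β) • δ k‖ ≤ κ') :
    ‖∑ j with M.c j = M.c m, w j • X j‖ ≤ s * (W * (C * h ^ 4)) + h ^ 3 * κ + h * κ' := by
  refine (ContinuousMap.norm_le _ (by positivity)).2 fun θ => ?_
  -- The point `β` depends on the stage only through its abscissa, so one `β` serves the whole
  -- group.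
  have hβ := max_zero_mem_Icc (M := M) hh m θ
  set β := max 0 (M.c m + θ / h)
  set R : Fin s → E := fun j => X j θ - h • ∑ k, (M.a j k).eval β • δ k
    + (h ^ 2 * M.gammaStage j 2 β) • Y2 + (h ^ 3 * M.gammaStage j 3 β) • Y3 with hR
  have hRle : ∀ j, M.c j = M.c m → ‖w j • R j‖ ≤ W * (C * h ^ 4) := by
    intro j hj
    have := H.X_sub_le j θ
    rw [hj] at this
    rw [norm_smul, Real.norm_eq_abs]
    exact mul_le_mul (hw j) this (norm_nonneg _) hW
  have e : (∑ j with M.c j = M.c m, w j • X j) θ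
      = ∑ j with M.c j = M.c m, w j • R j
        + h • ∑ k, (∑ j with M.c j = M.c m, w j * (M.a j k).eval β) • δ k
        - h ^ 3 • ∑ j with M.c j = M.c m, (w j * M.gammaStage j 3 β) • Y3
        - h ^ 2 • (∑ j with M.c j = M.c m, w j * M.gammaStage j 2 β) • Y2 := by
    simp only [Finset.sum_smul, Finset.smul_sum]
    rw [Finset.sum_comm, ← Finset.sum_add_distrib, ← Finset.sum_sub_distrib,
      ← Finset.sum_sub_distrib, ContinuousMap.sum_apply]
    refine Finset.sum_congr rfl fun j _ => ?_
    simp only [hR, ContinuousMap.smul_apply, smul_sub, smul_add, Finset.smul_sum, smul_smul]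
    have e1 : ∀ k, w j * (h * (M.a j k).eval β) = h * (w j * (M.a j k).eval β) :=
      fun k => by ring
    have e2 : w j * (h ^ 2 * M.gammaStage j 2 β) = h ^ 2 * (w j * M.gammaStage j 2 β) := by ring
    have e3 : w j * (h ^ 3 * M.gammaStage j 3 β) = h ^ 3 * (w j * M.gammaStage j 3 β) := by ring
    simp only [e1, e2, e3]
    abel
  rw [e, h2 β hβ, zero_smul, smul_zero, sub_zero]
  have n1 := norm_sum_filter_le (x := fun j => w j • R j) (by positivity)
    (fun j => M.c j = M.c m) hRle
  have n2 : ‖h • ∑ k, (∑ j with M.c j = M.c m, w j * (M.a j k).eval β) • δ k‖ ≤ h * κ' := by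
    rw [norm_smul, Real.norm_of_nonneg hh.le]
    exact mul_le_mul_of_nonneg_left (ha β hβ) hh.le
  have n3 : ‖h ^ 3 • ∑ j with M.c j = M.c m, (w j * M.gammaStage j 3 β) • Y3‖ ≤ h ^ 3 * κ := by
    rw [norm_smul, Real.norm_of_nonneg (by positivity)]
    exact mul_le_mul_of_nonneg_left (h3 β hβ) (by positivity)
  refine (norm_sub_le _ _).trans ((add_le_add ((norm_add_le _ _).trans
    (add_le_add n1 n2)) n3).trans (le_of_eq ?_))
  ring

variable (r E) in
/-- Under the order conditions the stage values contribute `O(h⁵)` to the error of one step. -/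
lemma StageErrors.exists_sum_bound (hM : M.CoeffBound B) (hB : 0 ≤ B) (hL : 0 ≤ L) (hC : 0 ≤ C)
    (hρ : 0 < ρ)
    (h_two : ∀ m : Fin s, ∀ α ∈ Icc (0 : ℝ) 1, ∀ β ∈ Icc (0 : ℝ) (M.c m),
      ∑ i with M.c i = M.c m, (M.b i).eval α * M.gammaStage i 2 β = 0)
    (h_single : ∀ m : Fin s, ∀ α ∈ Icc (0 : ℝ) 1, ∀ β ∈ Icc (0 : ℝ) (M.c m),
      ∑ i with M.c i = M.c m, (M.b i).eval α * M.gammaStage i 3 β = 0)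
    (h_double : ∀ m l : Fin s, ∀ α ∈ Icc (0 : ℝ) 1, ∀ β ∈ Icc (0 : ℝ) (M.c m),
      ∀ γ ∈ Icc (0 : ℝ) (M.c l),
        ∑ i with M.c i = M.c m, ∑ j with M.c j = M.c l,
          (M.b i).eval α * (M.a i j).eval β * M.gammaStage j 2 γ = 0) :
    ∃ D : ℝ, 0 ≤ D ∧ ∀ᶠ h in 𝓝[>] (0 : ℝ), ∀ (Y2 Y3 : E) (A : ℝ → Hist r E →L[ℝ] E)
      (δ : Fin s → E) (X : Fin s → Hist r E), M.StageErrors B L C ρ h Y2 Y3 A δ X →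
      ∀ α ∈ Icc (0 : ℝ) 1, ‖∑ j, (M.b j).eval α • δ j‖ ≤ D * h ^ 4 := by
  obtain ⟨D, hD0, hD⟩ := StageErrors.exists_bound r E hM hB hL hC hρ
  set W := s * (B * B)
  have hW0 : 0 ≤ W := by positivity
  set D1 := s * (W * C) + s * (W * B * C) + s * (s * (W * B) * D)
  set D2 := s * (W * D) + s * (L * D1)
  set D3 := s * (B * C) + D2
  refine ⟨s * (B * D) + s * (L * D3), by positivity, ?_⟩
  have ev3 : ∀ᶠ h in 𝓝[>] (0 : ℝ), h < 1 := nhdsWithin_le_nhds (gt_mem_nhds one_pos)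
  filter_upwards [hD, ev3, self_mem_nhdsWithin] with h hD h1 hh Y2 Y3 A δ X H α hα
  replace hh : 0 < h := hh
  specialize hD Y2 Y3 A δ X H
  have h43 : h ^ 4 ≤ h ^ 3 := pow_le_pow_of_le_one hh.le h1.le (by norm_num)
  have hb : ∀ j, |(M.b j).eval α| ≤ B := fun j => hM.b j α hα
  have hsum : ∀ m, ∀ β ∈ Icc 0 (M.c m), ∀ k,
      |∑ j with M.c j = M.c m, (M.b j).eval α * (M.a j k).eval β| ≤ W := by
    intro m β hβ k
    rw [← Real.norm_eq_abs]
    refine norm_sum_filter_le (by positivity) (fun j => M.c j = M.c m) fun j hj => ?_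
    rw [norm_mul]
    exact mul_le_mul (hb j) (hM.a j k β (hj ▸ hβ)) (norm_nonneg _) hB
  -- Inner substitution: `h_double` removes the `h²` term from the group sums with weights `w`. They
  -- are then `O(h³)`, since `Γ_j3` enters with `h³` and the `δ_k = O(h²)` enter with a further `h`.
  have step1 : ∀ m, ∀ β ∈ Icc 0 (M.c m),
      ‖∑ k, (∑ j with M.c j = M.c m, (M.b j).eval α * (M.a j k).eval β) • δ k‖
        ≤ D2 * h ^ 3 := by
    intro m β hβ
    set w : Fin s → ℝ := fun k => ∑ j with M.c j = M.c m, (M.b j).eval α * (M.a j k).eval β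
    have hw : ∀ k, |w k| ≤ W := hsum m β hβ
    have hcl : ∀ l, ‖∑ k with M.c k = M.c l, w k • X k‖ ≤ D1 * h ^ 3 := by
      intro l
      refine (H.norm_sum_filter_smul_le hC hh hW0 hw l (κ := s * (W * B * C))
        (κ' := s * (s * (W * B) * (D * h ^ 2))) (by positivity) (by positivity)
        (fun γ hγ => ?_) (fun γ hγ => ?_) (fun γ hγ => ?_)).trans ?_
      · rw [← h_double m l α hα β hβ γ hγ, Finset.sum_comm]
        exact Finset.sum_congr rfl fun j _ => Finset.sum_mul _ _ _
      · refine norm_sum_filter_le (by positivity) (fun j => M.c j = M.c l) fun j hj => ?_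
        rw [norm_smul, norm_mul]
        exact mul_le_mul (mul_le_mul (hw j) (hM.gammaStage j 3 γ (hj ▸ hγ)) (norm_nonneg _) hW0)
          H.Y3_le (norm_nonneg _) (by positivity)
      · have := norm_smul_sum_smul_le (z := δ) (h := 1) zero_le_one
          (b := fun k => ∑ j with M.c j = M.c l, w j * (M.a j k).eval γ) (B := s * (W * B))
          (fun k => (Real.norm_eq_abs _).symm.trans_le <|
            norm_sum_filter_le (by positivity) (fun j => M.c j = M.c l) fun j hj => by
            rw [norm_mul]
            exact mul_le_mul (hw j) (hM.a j k γ (hj ▸ hγ)) (abs_nonneg _) hW0)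
          (fun k => (hD k).2.1)
        simpa using this
      · have : s * (W * (C * h ^ 4)) ≤ s * (W * (C * h ^ 3)) := by gcongr
        simp only [D1]
        linarith
    refine (H.norm_sum_smul_le hL (fun j => (hD j).2.2) hw (by positivity) hcl).trans ?_
    have : s * (W * (D * h ^ 4)) ≤ s * (W * (D * h ^ 3)) := by gcongr
    simp only [D2]
    linarith
  -- Outer substitution: `h_two` and `h_single` remove the `h²` and `h³` terms, and the sum bounded
  -- in `step1` enters with a further factor `h`.
  have step2 : ∀ m, ‖∑ j with M.c j = M.c m, (M.b j).eval α • X j‖ ≤ D3 * h ^ 4 := by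
    intro m
    refine (H.norm_sum_filter_smul_le hC hh hB hb m le_rfl (by positivity)
      (fun β hβ => h_two m α hα β hβ) (fun β hβ => ?_) (step1 m)).trans (le_of_eq ?_)
    · rw [← Finset.sum_smul, h_single m α hα β hβ, zero_smul, norm_zero]
    · simp only [D3]; ring
  refine (H.norm_sum_smul_le hL (fun j => (hD j).2.2) hb (by positivity) step2).trans
    (le_of_eq ?_)
  ring

end TSRK

/-! ### The error of one step with exact input. -/

namespace SmoothProblem

variable {l m : ℕ} (P : SmoothProblem l m)

lemma mesh_sub_two (N n : ℕ) : P.mesh N (n - 2) = P.mesh N (n - 1) - P.step N := by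
  simp only [mesh]
  push_cast
  ring

/-- `Y` are the Taylor coefficients of the exact solution at `t`, with remainders bounded in terms
of `C` on `[t - h, t + R h]`. -/
structure IsTaylor (t h R C : ℝ) (Y : ℕ → EuclideanSpace ℝ (Fin P.d)) : Prop where
  zero : P.y t = Y 0
  le : ∀ k ≤ 5, ‖Y k‖ ≤ C
  y_le : ∀ x ∈ Icc (-h) (R * h),
    ‖P.y (t + x) - ∑ k ∈ Finset.range (4 + 1), (x ^ k / (k.factorial : ℝ)) • Y k‖
      ≤ C * |x| ^ (4 + 1)
  exactK_le : ∀ x ∈ Icc (-h) (R * h),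
    ‖P.exactK (t + x) - ∑ k ∈ Finset.range 4, (x ^ k / (k.factorial : ℝ)) • Y (k + 1)‖
      ≤ C * |x| ^ 4

lemma step_pos {N : ℕ} (hN : 0 < N) : 0 < P.step N :=
  div_pos (sub_pos.2 P.t₀_lt) (by exact_mod_cast hN)

lemma tendsto_step : Tendsto P.step atTop (𝓝[>] 0) := by
  refine tendsto_nhdsWithin_iff.2 ⟨tendsto_const_div_atTop_nhds_zero_nat _, ?_⟩
  filter_upwards [eventually_gt_atTop 0] with N hN using P.step_pos hN

lemma exists_isTaylor {s : ℕ} (M : TSRK s) (hm : 5 ≤ m) : ∃ C : ℝ, 0 ≤ C ∧ ∀ N n : ℕ, 0 < N →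
    M.RegularStep P N n → ∃ Y, P.IsTaylor (P.mesh N (n - 1)) (P.step N) M.reach C Y := by
  obtain ⟨C, hC0, hC⟩ := P.exists_taylor_bound (n := 4) hm
  refine ⟨C, hC0, fun N n hN hreg => ?_⟩
  obtain ⟨h1, h2, h3⟩ := hreg
  have hh := P.step_pos hN
  have hR := mul_pos (one_pos.trans_le M.one_le_reach) hh
  rw [mesh_sub_two] at h1 h3
  obtain ⟨Y, hY0, hYle, hY⟩ := hC _ _ h1 (by linarith) h2 h3 (P.mesh N (n - 1))
    ⟨by linarith, by linarith⟩
  exact ⟨Y, hY0.symm, hYle, fun x hx => (hY x ⟨by linarith [hx.1], by linarith [hx.2]⟩).1,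
    fun x hx => (hY x ⟨by linarith [hx.1], by linarith [hx.2]⟩).2⟩

end SmoothProblem

namespace TSRK

variable {s : ℕ} {M : TSRK s} {l m : ℕ} {P : SmoothProblem l m} {N n : ℕ}
  {η : C(ℝ, EuclideanSpace ℝ (Fin P.d))} {K : Fin s → EuclideanSpace ℝ (Fin P.d)}
  {Ys : Fin s → C(ℝ, EuclideanSpace ℝ (Fin P.d))} {B C : ℝ}
  {Y : ℕ → EuclideanSpace ℝ (Fin P.d)}

lemma step_smul_residual (hh : P.step N ≠ 0) (α : ℝ) : P.step N • M.residual P N n α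
    = P.y (P.mesh N (n - 1) + α * P.step N)
    - ((1 - M.v.eval α) • P.y (P.mesh N (n - 2)) + M.v.eval α • P.y (P.mesh N (n - 1))
      + P.step N • ∑ j, (M.bT j).eval α • P.exactK (P.mesh N (n - 2) + M.c j * P.step N)
      + P.step N • ∑ j, (M.b j).eval α • P.exactK (P.mesh N (n - 1) + M.c j * P.step N)) := by
  rw [residual, smul_inv_smul₀ hh]

/-- The error of one step in terms of the residual and the errors of the stage values. -/
lemma IsStepFromExact.error_eq (H : M.IsStepFromExact P N n η K Ys) (hh : P.step N ≠ 0) {α : ℝ}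
    (hα : α ∈ Icc (0 : ℝ) 1) :
    P.y (P.mesh N (n - 1) + α * P.step N) - η (α * P.step N) = P.step N • M.residual P N n α
      + P.step N • ∑ j, (M.b j).eval α •
        (P.exactK (P.mesh N (n - 1) + M.c j * P.step N) - K j) := by
  rw [step_smul_residual hh, H.eta α hα]
  simp only [ContinuousMap.coe_mk, add_zero, smul_sub, Finset.sum_sub_distrib]
  rw [P.mesh_sub_two, sub_add_cancel]
  abel

/-- Expansion of the residual. -/
lemma norm_residual_add_le (hM : M.CoeffBound B) (hN : 0 < N)
    (hC : 0 ≤ C) (hY : P.IsTaylor (P.mesh N (n - 1)) (P.step N) M.reach C Y) {α : ℝ}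
    (hα : α ∈ Icc (0 : ℝ) 1) :
    ‖P.step N • M.residual P N n α
      + ∑ k ∈ Finset.range 4, (P.step N ^ (k + 1) * M.gamma (k + 1) α) • Y (k + 1)‖
      ≤ (2 + B + 2 * s * B) * C * M.reach ^ 5 * P.step N ^ 5 := by
  have hh := P.step_pos hN
  have key := norm_quad_sub_le (n := 4) (y := fun x => P.y (P.mesh N (n - 1) + x))
    (z := fun x => P.exactK (P.mesh N (n - 1) + x)) hh.le M.one_le_reach hC
    ⟨hα.1, hα.2.trans M.one_le_reach⟩ (fun j => ⟨M.c_nonneg j, M.c_le_reach j⟩)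
    (hM.v α hα) (fun j => hM.bT j α hα) (fun j => hM.b j α hα) (by simpa using hY.zero)
    hY.y_le hY.exactK_le
  rw [step_smul_residual hh.ne', P.mesh_sub_two]
  simp only [← gamma_eq_quadDefect] at key
  simpa only [add_zero, ← add_assoc, ← sub_eq_add_neg] using key

lemma norm_residual_le (hM : M.CoeffBound B) (hN : 0 < N) (hC : 0 ≤ C)
    (hY : P.IsTaylor (P.mesh N (n - 1)) (P.step N) M.reach C Y) {α : ℝ}
    (hα : α ∈ Icc (0 : ℝ) 1) (h1 : M.gamma 1 α = 0) (h2 : M.gamma 2 α = 0)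
    (h3 : M.gamma 3 α = 0) (h4 : M.gamma 4 α = 0) :
    ‖P.step N • M.residual P N n α‖
      ≤ (2 + B + 2 * s * B) * C * M.reach ^ 5 * P.step N ^ 5 := by
  have := norm_residual_add_le hM hN hC hY hα
  simpa [Finset.sum_range_succ, h1, h2, h3, h4] using this

/-- The bridge from an actual step to the abstract error relations. One constant serves all of them:
its summands cover the quadrature remainder, the `Γ_j4` term, the derivatives of `y` and the
quadratic remainder of `f`. -/
lemma IsStepFromExact.stageErrors (H : M.IsStepFromExact P N n η K Ys) (h_one : M.StageOrderOne)
    (hM : M.CoeffBound B) (hB : 0 ≤ B) (hN : 0 < N) (hN1 : P.step N ≤ 1)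
    (hreg : M.RegularStep P N n)
    (hC : 0 ≤ C) (hY : P.IsTaylor (P.mesh N (n - 1)) (P.step N) M.reach C Y) {L Cq ρ : ℝ}
    (hCq : 0 ≤ Cq) (hL : ∀ t φ, ‖fderiv ℝ (P.f t) φ‖ ≤ L)
    (hq : ∀ t ∈ Icc P.σ P.τ, ∀ φ, ‖φ - shift P.r P.y t‖ < ρ →
      ‖P.f t φ - P.f t (shift P.r P.y t)
        - fderiv ℝ (P.f t) (shift P.r P.y t) (φ - shift P.r P.y t)‖
        ≤ Cq * ‖φ - shift P.r P.y t‖ ^ 2) :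
    M.StageErrors B L ((2 + B + 2 * s * B) * C * M.reach ^ 5 + B * C + C + Cq) ρ (P.step N)
      (Y 2) (Y 3) (fun x => fderiv ℝ (P.f (P.mesh N (n - 1) + x * P.step N))
        (shift P.r P.y (P.mesh N (n - 1) + x * P.step N)))
      (fun j => P.exactK (P.mesh N (n - 1) + M.c j * P.step N) - K j)
      (fun j => shift P.r P.y (P.mesh N (n - 1) + M.c j * P.step N)
        - shift P.r (Ys j) (M.c j * P.step N)) := by
  have hh := P.step_pos hN
  have hR0 : 0 ≤ M.reach := zero_le_one.trans M.one_le_reach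
  have hQ : 0 ≤ (2 + B + 2 * s * B) * C * M.reach ^ 5 := by positivity
  have hBC : 0 ≤ B * C := by positivity
  have ht : ∀ j, P.mesh N (n - 1) + M.c j * P.step N ∈ Icc P.σ P.τ := by
    intro j
    obtain ⟨h1, h2, -⟩ := hreg
    rw [P.mesh_sub_two] at h1
    have h3 := mul_nonneg (M.c_nonneg j) hh.le
    have h4 := mul_le_mul_of_nonneg_right (M.c_le_reach j) hh.le
    exact ⟨by linarith, by linarith⟩
  refine ⟨?_, ?_, fun x => hL _ _, fun j => ?_, fun j hj => ?_, fun j θ => ?_⟩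
  · have := hY.le 2 (by norm_num); linarith
  · have := hY.le 3 (by norm_num); linarith
  · rw [H.stage_value j]
    exact convex_univ.norm_image_sub_le_of_norm_fderiv_le
      (fun φ _ => P.rhs.differentiable _ φ) (fun φ _ => hL _ φ) (mem_univ _) (mem_univ _)
  · rw [H.stage_value j]
    set t := P.mesh N (n - 1) + M.c j * P.step N
    have h1 := hq t (ht j) (shift P.r (Ys j) (M.c j * P.step N)) (by rwa [norm_sub_rev])
    rw [norm_sub_rev _ (shift P.r P.y t), ← norm_neg] at h1
    have e : P.exactK t - P.f t (shift P.r (Ys j) (M.c j * P.step N))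
        - fderiv ℝ (P.f t) (shift P.r P.y t)
          (shift P.r P.y t - shift P.r (Ys j) (M.c j * P.step N))
        = -(P.f t (shift P.r (Ys j) (M.c j * P.step N)) - P.f t (shift P.r P.y t)
        - fderiv ℝ (P.f t) (shift P.r P.y t)
          (shift P.r (Ys j) (M.c j * P.step N) - shift P.r P.y t)) := by
      rw [← neg_sub (shift P.r P.y t), map_neg]
      simp only [SmoothProblem.exactK]
      abel
    rw [e]
    refine h1.trans ?_
    gcongr
    linarith
  · change ‖P.y (P.mesh N (n - 1) + M.c j * P.step N + θ) - Ys j (M.c j * P.step N + θ)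
      - _ + _ + _‖ ≤ _
    have hθ : M.c j * P.step N + (θ : ℝ) = (M.c j + θ / P.step N) * P.step N := by
      rw [add_mul, div_mul_cancel₀ _ hh.ne']
    have hβ := max_zero_mem_Icc (M := M) hh j θ
    rw [add_assoc (P.mesh N (n - 1)), hθ]
    -- Either the time lies in the current step and the quadrature expansion applies, or it lies in
    -- the past, where the stage coincides with the exact solution.
    rcases le_total 0 (M.c j + θ / P.step N) with h0 | h0
    · rw [max_eq_right h0] at hβ ⊢
      set β := M.c j + θ / P.step N
      have key := norm_quad_sub_le (n := 4) (y := fun x => P.y (P.mesh N (n - 1) + x))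
        (z := fun x => P.exactK (P.mesh N (n - 1) + x)) hh.le M.one_le_reach hC
        ⟨hβ.1, hβ.2.trans (M.c_le_reach j)⟩ (fun j => ⟨M.c_nonneg j, M.c_le_reach j⟩)
        (hM.u j β hβ) (fun k => hM.aT j k β hβ) (fun k => hM.a j k β hβ)
        (by simpa using hY.zero) hY.y_le hY.exactK_le
      rw [H.stage j β hβ]
      simp only [← gammaStage_eq_quadDefect, Finset.sum_range_succ, Finset.sum_range_zero,
        zero_add, h_one.gammaStage_one hβ, mul_zero, zero_smul, Nat.reduceAdd, add_zero,
        ← add_assoc, ← sub_eq_add_neg] at key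
      simp only [ContinuousMap.coe_mk, add_zero, P.mesh_sub_two, sub_add_cancel]
      have h4 : ‖(P.step N ^ 4 * M.gammaStage j 4 β) • Y 4‖ ≤ B * C * P.step N ^ 4 := by
        rw [norm_smul, norm_mul, Real.norm_of_nonneg (by positivity), Real.norm_eq_abs]
        have h5 := hM.gammaStage j 4 β hβ
        have h6 := hY.le 4 (by norm_num)
        calc _ ≤ P.step N ^ 4 * B * C := by gcongr; exact h5
          _ = _ := by ring
      have h5 : (2 + B + 2 * s * B) * C * M.reach ^ 5 * P.step N ^ 5
          ≤ (2 + B + 2 * s * B) * C * M.reach ^ 5 * P.step N ^ 4 := by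
        gcongr _ * ?_
        exact pow_le_pow_of_le_one hh.le hN1 (by norm_num)
      have h6 : 0 ≤ (C + Cq) * P.step N ^ 4 := by positivity
      refine le_trans (le_of_eq_of_le ?_ ((norm_sub_le _ _).trans
        (add_le_add (key.trans h5) h4))) ?_
      · congr 1
        simp only [smul_sub, Finset.sum_sub_distrib]
        abel
      · linarith
    · rw [max_eq_left h0, ← hθ]
      have h1 : M.c j * P.step N + (θ : ℝ) ≤ 0 := by
        rw [hθ]; exact mul_nonpos_of_nonpos_of_nonneg h0 hh.le
      have h2 := mul_nonneg (M.c_nonneg j) hh.le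
      rw [H.stage_past j _ ⟨by linarith [θ.2.1], h1⟩]
      simp only [ContinuousMap.coe_mk, P.mesh_sub_two, M.a_zero,
        gammaStage_zero_right j two_ne_zero, gammaStage_zero_right j three_ne_zero, zero_smul,
        mul_zero, Finset.sum_const_zero, smul_zero]
      rw [show ∀ x, P.mesh N (n - 1) + x = P.mesh N (n - 1) - P.step N + (P.step N + x) from
        fun x => by ring]
      simp only [sub_self, add_zero, norm_zero]
      positivity

end TSRK

/-! ### Test problems with solution `t^k`. -/

lemma IsSmoothRHS.mono {E : Type} [NormedAddCommGroup E] [NormedSpace ℝ E] {r : ℝ} {l l' : ℕ}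
    {f : ℝ → Hist r E → E} (H : IsSmoothRHS r l f) (hl : l' ≤ l) : IsSmoothRHS r l' f where
  continuous := H.continuous
  differentiable := H.differentiable
  bounded_fderiv := H.bounded_fderiv
  contDiff t := (H.contDiff t).of_le (by exact_mod_cast hl)
  locally_bounded k hk := H.locally_bounded k (hk.trans hl)

/-- A right-hand side that is affine in the second argument is smooth. -/
lemma isSmoothRHS_of_affine {E : Type} [NormedAddCommGroup E] [NormedSpace ℝ E] {r : ℝ} (l : ℕ)
    {f : ℝ → Hist r E → E} (hf : Continuous fun p : ℝ × Hist r E => f p.1 p.2) (g : ℝ → E)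
    (A : ℝ → Hist r E →L[ℝ] E) {L : ℝ} (hA : ∀ t, ‖A t‖ ≤ L)
    (hfA : ∀ t φ, f t φ = g t + A t φ) : IsSmoothRHS r l f := by
  have hf' : ∀ t, f t = fun φ => g t + A t φ := fun t => funext (hfA t)
  have hder : ∀ t, fderiv ℝ (f t) = fun _ => A t := by
    intro t
    funext φ
    rw [hf' t]
    exact ((A t).hasFDerivAt.const_add _).fderiv
  refine ⟨hf, fun t => ?_, ⟨L, fun t φ => ?_⟩, fun t => ?_, fun k _ t φ => ?_⟩
  · rw [hf' t]; fun_prop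
  · rw [hder]; exact hA t
  · rw [hf' t]; exact contDiff_const.add (A t).contDiff
  -- Values are bounded locally by continuity, first derivatives by `L`, and all higher derivatives
  -- vanish.
  · cases k with
    | zero =>
      refine ⟨‖f t φ‖ + 1, ?_⟩
      simp only [norm_iteratedFDeriv_zero]
      exact (ContinuousAt.eventually_lt (hf.norm.continuousAt (x := (t, φ))) continuousAt_const
        (by simp)).mono fun _ h => h.le
    | succ k =>
      refine ⟨L, Eventually.of_forall fun p => ?_⟩
      rw [← norm_iteratedFDeriv_fderiv, hder]
      cases k with
      | zero => rw [norm_iteratedFDeriv_zero]; exact hA _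
      | succ k =>
        rw [iteratedFDeriv_const_of_ne (by omega)]
        simpa using (norm_nonneg (A 0)).trans (hA 0)

namespace SmoothProblem

/-- A problem of class `C^{l,m}` is also one with less smoothness. -/
def weaken {l m l' m' : ℕ} (P : SmoothProblem l m) (hl : l' ≤ l) (hm : m' ≤ m) :
    SmoothProblem l' m' where
  d := P.d
  r := P.r
  r_nonneg := P.r_nonneg
  f := P.f
  rhs := P.rhs.mono hl
  σ := P.σ
  t₀ := P.t₀
  T := P.T
  τ := P.τ
  σ_le := P.σ_le
  t₀_lt := P.t₀_lt
  le_τ := P.le_τ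
  y := P.y
  solution := P.solution
  breaks := P.breaks
  piecewise p q hp hpq hq hb := (P.piecewise p q hp hpq hq hb).of_le (by exact_mod_cast hm)

/-- The function `t ↦ t ^ k`, with values in the one-dimensional Euclidean space. -/
def powCurve (k : ℕ) : C(ℝ, EuclideanSpace ℝ (Fin 1)) where
  toFun t := t ^ k • EuclideanSpace.single 0 1
  continuous_toFun := by fun_prop

/-- The right-hand side `k t^(k-1) + μ (φ(λ(t)) - (t + λ(t))^k)`. -/
def powRHS (k : ℕ) (μ : ℝ) {r : ℝ} (lag : C(ℝ, Icc (-r) (0 : ℝ))) (t : ℝ)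
    (φ : Hist r (EuclideanSpace ℝ (Fin 1))) : EuclideanSpace ℝ (Fin 1) :=
  (k * t ^ (k - 1)) • EuclideanSpace.single 0 1 + μ • (φ (lag t) - powCurve k (t + lag t))

lemma isSmoothRHS_powRHS (k l : ℕ) (μ : ℝ) {r : ℝ} (lag : C(ℝ, Icc (-r) (0 : ℝ))) :
    IsSmoothRHS r l (powRHS k μ lag) := by
  refine isSmoothRHS_of_affine l ?_
    (fun t => (k * t ^ (k - 1)) • EuclideanSpace.single 0 1 - μ • powCurve k (t + lag t))
    (fun t => μ • ContinuousMap.evalCLM ℝ (lag t)) (L := |μ|) (fun t => ?_) (fun t φ => ?_)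
  · unfold powRHS
    fun_prop
  · refine ContinuousLinearMap.opNorm_le_bound _ (abs_nonneg _) fun φ => ?_
    simp only [_root_.smul_apply, ContinuousMap.evalCLM_apply, norm_smul,
      Real.norm_eq_abs]
    gcongr
    exact φ.norm_coe_le_norm _
  · simp only [powRHS, _root_.smul_apply, ContinuousMap.evalCLM_apply, smul_sub]
    abel

lemma powRHS_shift (k : ℕ) (μ : ℝ) {r : ℝ} (lag : C(ℝ, Icc (-r) (0 : ℝ))) (t : ℝ) :
    powRHS k μ lag t (shift r (powCurve k) t)
      = (k * t ^ (k - 1)) • EuclideanSpace.single 0 1 := by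
  simp [powRHS, shift]

/-- A problem with the exact solution `t ^ k`. -/
abbrev powProblem (l m k : ℕ) (μ : ℝ) {R : ℝ} (hR : 0 ≤ R)
    (lag : C(ℝ, Icc (-(R + 1)) (0 : ℝ))) : SmoothProblem l m where
  d := 1
  -- This history is long enough for a delay to lead from any time in `[0, R + 1]` back to `0`.
  r := R + 1
  r_nonneg := by linarith
  f := powRHS k μ lag
  rhs := isSmoothRHS_powRHS k l μ lag
  σ := -1
  t₀ := 0
  T := 1
  τ := R + 1
  σ_le := by norm_num
  t₀_lt := one_pos
  le_τ := by linarith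
  y := powCurve k
  solution t _ := by
    rw [powRHS_shift]
    exact ((hasDerivAt_pow k t).smul_const _).hasDerivWithinAt
  breaks := ∅
  piecewise p q _ _ _ _ := by
    refine ContDiff.contDiffOn ?_
    change ContDiff ℝ m fun t : ℝ => t ^ k • (EuclideanSpace.single 0 1 : EuclideanSpace ℝ (Fin 1))
    fun_prop

variable {l m k : ℕ} {μ R : ℝ} {hR : 0 ≤ R} {lag : C(ℝ, Icc (-(R + 1)) (0 : ℝ))}

lemma powProblem_exactK (t : ℝ) : (powProblem l m k μ hR lag).exactK t
    = ((k : ℝ) * t ^ (k - 1)) • (EuclideanSpace.single 0 1 : EuclideanSpace ℝ (Fin 1)) :=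
  powRHS_shift k μ lag t

lemma powProblem_mesh (N : ℕ) :
    (powProblem l m k μ hR lag).mesh N ((1 : ℕ) - 1) = 0 := by
  simp [mesh, powProblem]

lemma powProblem_step (N : ℕ) : (powProblem l m k μ hR lag).step N = 1 / N := by
  simp [step]

/-- The Taylor coefficients of `t ^ k` at zero. -/
def powTaylor (k j : ℕ) : EuclideanSpace ℝ (Fin 1) :=
  if j = k then (k.factorial : ℝ) • EuclideanSpace.single 0 1 else 0

lemma sum_powTaylor {k n : ℕ} (hk : k < n) (x : ℝ) :
    ∑ j ∈ Finset.range n, (x ^ j / (j.factorial : ℝ)) • powTaylor k j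
      = x ^ k • EuclideanSpace.single 0 1 := by
  rw [Finset.sum_eq_single_of_mem k (Finset.mem_range.2 hk)
    fun j _ hj => by simp [powTaylor, hj]]
  have : (k.factorial : ℝ) ≠ 0 := by positivity
  simp [powTaylor, smul_smul, this]

lemma sum_powTaylor_succ {k n : ℕ} (hk : k < n) (x : ℝ) :
    ∑ j ∈ Finset.range n, (x ^ j / (j.factorial : ℝ)) • powTaylor (k + 1) (j + 1)
      = ((k + 1 : ℕ) * x ^ k : ℝ) • EuclideanSpace.single 0 1 := by
  rw [Finset.sum_eq_single_of_mem k (Finset.mem_range.2 hk)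
    fun j _ hj => by simp [powTaylor, hj]]
  have : (k.factorial : ℝ) ≠ 0 := by positivity
  simp only [powTaylor, if_true, smul_smul, Nat.factorial_succ]
  congr 1
  push_cast
  field_simp

lemma powProblem_isTaylor {t : ℝ} (ht : t = 0) (h : ℝ) (hk : k < 4) :
    (powProblem l m (k + 1) μ hR lag).IsTaylor t h R 24 (powTaylor (k + 1)) where
  zero := by
    subst ht
    change powCurve (k + 1) 0 = _
    simp [powCurve, powTaylor]
  le j _ := by
    unfold powTaylor
    split_ifs
    · rw [norm_smul]
      -- The constant `24` is `4!`; the remainders themselves are zero, because `t^(k+1)` is its own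
      -- Taylor polynomial.
      have : (k + 1).factorial ≤ Nat.factorial 4 := Nat.factorial_le hk
      simp only [RCLike.norm_natCast, PiLp.norm_single, norm_one, mul_one]
      exact_mod_cast this
    · simp
  y_le x _ := by
    subst ht
    rw [sum_powTaylor (by omega)]
    change ‖powCurve (k + 1) (0 + x) - _‖ ≤ _
    simp only [powCurve, zero_add, ContinuousMap.coe_mk, sub_self, norm_zero]
    positivity
  exactK_le x _ := by
    subst ht
    rw [sum_powTaylor_succ hk, powProblem_exactK]
    simp only [zero_add, Nat.add_sub_cancel, sub_self, norm_zero]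
    positivity

lemma powProblem_regularStep {s : ℕ} {M : TSRK s} {hR : 0 ≤ M.reach}
    {lag : C(ℝ, Icc (-(M.reach + 1)) (0 : ℝ))} {N : ℕ} (hN : 0 < N) :
    M.RegularStep (powProblem l m k μ hR lag) N 1 := by
  have h1 : (1 : ℝ) / N ≤ 1 := by
    rw [div_le_one (by exact_mod_cast hN)]
    exact_mod_cast hN
  refine ⟨?_, ?_, by simp [powProblem]⟩
  · rw [mesh_sub_two, powProblem_mesh, powProblem_step]
    simp only
    linarith
  · rw [powProblem_mesh, powProblem_step]
    simp only
    nlinarith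

/-- Dividing by `h^a` and letting `h → 0` along a subsequence suffices, which permits test problems
adapted to special step sizes only. -/
lemma eq_zero_of_frequently (P : SmoothProblem l m) {S D : ℝ} {a : ℕ}
    (H : ∃ᶠ N : ℕ in atTop, |S| * P.step N ^ a ≤ D * P.step N ^ (a + 1)) : S = 0 := by
  by_contra hS
  have h1 : Tendsto (fun N => D * P.step N) atTop (𝓝 (D * 0)) :=
    (tendsto_nhdsWithin_iff.1 P.tendsto_step).1.const_mul D
  rw [mul_zero] at h1
  have h2 := h1.eventually (gt_mem_nhds (abs_pos.2 hS))
  refine H ?_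
  filter_upwards [h2, eventually_gt_atTop 0] with N hN hN0
  rw [not_le, pow_succ', ← mul_assoc]
  exact mul_lt_mul_of_pos_right hN (pow_pos (P.step_pos hN0) _)

end SmoothProblem

/-! ### A log-periodic selector of abscissae. -/

/-- A continuous function with `0 ≤ ρ x ≤ x` that, at the points `c j / R ^ i`, selects the indices
`j` with `c j = c m`. -/
lemma exists_selector {s : ℕ} (c : Fin s → ℝ) (hc : ∀ j, 0 ≤ c j) (m : Fin s) (hm : 0 < c m)
    {β : ℝ} (hβ : β ∈ Icc 0 (c m)) : ∃ (ρ : ℝ → ℝ) (R : ℕ), Continuous ρ ∧ 2 ≤ R ∧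
    (∀ x, 0 ≤ x → ρ x ∈ Icc 0 x) ∧
    ∀ i : ℕ, ∀ j, ρ (c j * (1 / (R ^ i : ℕ))) = (if c j = c m then β else 0) * (1 / (R ^ i : ℕ)) := by
  -- With this `R` the phase `θ` at a positive `c j` lies strictly between `-π` and `π`, so its sine
  -- vanishes only if `c j = c m`. Dividing `x > 0` by `R` lowers the phase by `π` and preserves
  -- `|sin|`.
  obtain ⟨R, hR2, hR⟩ : ∃ R : ℕ, 2 ≤ R ∧ ∀ j, |Real.log (c j) - Real.log (c m)| < Real.log R := by
    have h1 : Tendsto (fun R : ℕ => Real.log R) atTop atTop :=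
      Real.tendsto_log_atTop.comp tendsto_natCast_atTop_atTop
    exact ((eventually_ge_atTop 2).and
      (eventually_all.2 fun j => h1.eventually_gt_atTop _)).exists
  have hR0 : (0 : ℝ) < R := by exact_mod_cast (by omega : 0 < R)
  have hlog : 0 < Real.log R := Real.log_pos (by exact_mod_cast (by omega : 1 < R))
  set θ : ℝ → ℝ := fun x => (Real.log x - Real.log (c m)) / Real.log R * Real.pi with hθ
  -- Since `A |sin (θ (c j))| ≥ 1` whenever the sine is nonzero, the cut-off `p` below is `0` at the
  -- unselected positive abscissae and `1` at the selected ones. Selected indices contribute `0⁻¹ =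
  -- 0` to `A`.
  set A := ∑ j, |Real.sin (θ (c j))|⁻¹ with hA
  have hA0 : 0 ≤ A := Finset.sum_nonneg fun _ _ => by positivity
  set p : ℝ → ℝ := fun x => max 0 (1 - A * |Real.sin (θ x)|) with hp
  have hp0 : ∀ x, 0 ≤ p x := fun x => le_max_left _ _
  have hp1 : ∀ x, p x ≤ 1 := fun x => max_le zero_le_one
    (sub_le_self _ (mul_nonneg hA0 (abs_nonneg _)))
  have hq : β / c m ∈ Icc (0 : ℝ) 1 := ⟨div_nonneg hβ.1 hm.le, div_le_one_of_le₀ hβ.2 hm.le⟩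
  refine ⟨fun x => β / c m * (x * p x), R, ?_, hR2, fun x hx => ⟨?_, ?_⟩, fun i j => ?_⟩
  · refine continuous_const.mul (continuous_iff_continuousAt.2 fun x => ?_)
    -- The function `p` may oscillate near `0`; the factor `x` restores continuity.
    by_cases hx : x = 0
    · subst hx
      rw [ContinuousAt, zero_mul]
      refine squeeze_zero_norm (a := fun x => |x|) (fun x => ?_) ?_
      · rw [norm_mul, Real.norm_eq_abs, Real.norm_of_nonneg (hp0 x)]
        exact mul_le_of_le_one_right (abs_nonneg _) (hp1 x)
      · simpa using (continuous_abs (G := ℝ)).tendsto 0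
    · have : ContinuousAt Real.log x := Real.continuousAt_log hx
      simp only [hp, hθ]
      fun_prop
  · exact mul_nonneg hq.1 (mul_nonneg hx (hp0 x))
  · exact (mul_le_of_le_one_left (mul_nonneg hx (hp0 x)) hq.2).trans
      (mul_le_of_le_one_right hx (hp1 x))
  · rcases (hc j).eq_or_lt with h0 | h0
    · rw [if_neg (by rw [← h0]; exact hm.ne), ← h0]
      simp
    have hRi : ((R ^ i : ℕ) : ℝ) ≠ 0 := by positivity
    have hsin : |Real.sin (θ (c j * (1 / (R ^ i : ℕ))))| = |Real.sin (θ (c j))| := by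
      have : θ (c j * (1 / (R ^ i : ℕ))) = θ (c j) - i * Real.pi := by
        simp only [hθ]
        rw [Real.log_mul h0.ne' (by positivity), one_div, Real.log_inv, Nat.cast_pow,
          Real.log_pow]
        field_simp
        ring
      rw [this, Real.sin_sub_nat_mul_pi, abs_mul, abs_pow, abs_neg, abs_one, one_pow, one_mul]
    simp only [hp, hsin]
    split_ifs with hjm
    · have : θ (c j) = 0 := by simp [hθ, hjm]
      rw [this, Real.sin_zero, abs_zero, mul_zero, sub_zero, max_eq_right zero_le_one, mul_one,
        hjm]
      field_simp
    · have hne : Real.sin (θ (c j)) ≠ 0 := by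
        have hlt : |(Real.log (c j) - Real.log (c m)) / Real.log R| < 1 := by
          rw [abs_div, abs_of_pos hlog, div_lt_one hlog]
          exact hR j
        rw [abs_lt] at hlt
        have hpi := Real.pi_pos
        rw [Ne, Real.sin_eq_zero_iff_of_lt_of_lt (by simp only [hθ]; nlinarith)
          (by simp only [hθ]; nlinarith)]
        simp only [hθ, mul_eq_zero, div_eq_zero_iff, sub_eq_zero, hpi.ne', hlog.ne', or_false]
        exact fun h => hjm (Real.log_injOn_pos h0 hm h)
      have hpos := abs_pos.2 hne
      have : 1 ≤ A * |Real.sin (θ (c j))| := by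
        have h1 : |Real.sin (θ (c j))|⁻¹ ≤ A :=
          Finset.single_le_sum (f := fun j => |Real.sin (θ (c j))|⁻¹)
            (fun _ _ => by positivity) (Finset.mem_univ j)
        calc (1 : ℝ) = |Real.sin (θ (c j))|⁻¹ * |Real.sin (θ (c j))| :=
              (inv_mul_cancel₀ hpos.ne').symm
          _ ≤ _ := by gcongr
      rw [max_eq_left (by linarith)]
      ring

/-! ### Conditions necessary for uniform order three. -/

namespace TSRK

open SmoothProblem

variable {s : ℕ} {M : TSRK s}

lemma eventually_step_le_one {l m : ℕ} (P : SmoothProblem l m) : ∀ᶠ N in atTop, P.step N ≤ 1 :=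
  ((tendsto_nhdsWithin_iff.1 P.tendsto_step).1.eventually (gt_mem_nhds one_pos)).mono
    fun _ h => h.le

lemma norm_smul_smul_single (x y : ℝ) :
    ‖x • (y • (EuclideanSpace.single 0 1 : EuclideanSpace ℝ (Fin 1)))‖ = |x| * |y| := by
  simp [norm_smul]

/-- If the residual of `t ^ (k + 1)` is of order three, then `Γ_{k+1}` vanishes. -/
lemma gamma_eq_zero_of_residual {l m k : ℕ} (hk : k ≤ 2) {μ : ℝ} {hR : 0 ≤ M.reach}
    {lag : C(ℝ, Icc (-(M.reach + 1)) (0 : ℝ))} {α : ℝ} (hα : α ∈ Icc (0 : ℝ) 1) {C : ℝ} {N₀ : ℕ}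
    (H : ∀ N ≥ N₀, 0 < N → ‖(powProblem l m (k + 1) μ hR lag).step N •
      M.residual (powProblem l m (k + 1) μ hR lag) N 1 α‖
        ≤ C * (powProblem l m (k + 1) μ hR lag).step N ^ 4) :
    M.gamma (k + 1) α = 0 := by
  obtain ⟨B, hB0, hB⟩ := M.exists_coeffBound
  set P := powProblem l m (k + 1) μ hR lag
  set C' := (2 + B + 2 * s * B) * 24 * M.reach ^ 5
  have hC' : 0 ≤ C' := by positivity
  refine P.eq_zero_of_frequently (D := |C| + C') (a := k + 1) (Eventually.frequently ?_)
  filter_upwards [eventually_ge_atTop N₀, eventually_gt_atTop 0, eventually_step_le_one P]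
    with N hN hN0 hN1
  have hh := P.step_pos hN0
  have key := norm_residual_add_le (n := 1) (P := P) (Y := powTaylor (k + 1)) hB hN0
    (by norm_num : (0 : ℝ) ≤ 24)
    (powProblem_isTaylor (powProblem_mesh N) _ (by omega)) hα
  -- Only one Taylor coefficient of `t^(k+1)` at `0` is nonzero, so the expansion isolates
  -- `Γ_{k+1}`.
  rw [Finset.sum_eq_single_of_mem k (Finset.mem_range.2 (by omega))
    fun j _ hj => by simp [powTaylor, hj]] at key
  set x := P.step N • M.residual P N 1 α
  set v := (P.step N ^ (k + 1) * M.gamma (k + 1) α) • powTaylor (k + 1) (k + 1) with hv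
  have hvn : ‖v‖ = P.step N ^ (k + 1) * |M.gamma (k + 1) α| * (k + 1).factorial := by
    rw [hv, powTaylor, if_pos rfl, norm_smul_smul_single, abs_mul, abs_of_pos (pow_pos hh _),
      Nat.abs_cast]
  have h1 : ‖v‖ ≤ ‖x + v‖ + ‖x‖ := by
    have := norm_sub_le (x + v) x
    rwa [add_sub_cancel_left] at this
  have h2 : P.step N ^ 4 ≤ P.step N ^ (k + 1 + 1) :=
    pow_le_pow_of_le_one hh.le hN1 (by omega)
  have h3 : P.step N ^ 5 ≤ P.step N ^ (k + 1 + 1) :=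
    pow_le_pow_of_le_one hh.le hN1 (by omega)
  have h4 : (1 : ℝ) ≤ (k + 1).factorial := by
    exact_mod_cast Nat.one_le_iff_ne_zero.2 (k + 1).factorial_ne_zero
  calc |M.gamma (k + 1) α| * P.step N ^ (k + 1)
      ≤ P.step N ^ (k + 1) * |M.gamma (k + 1) α| * (k + 1).factorial := by
        rw [mul_comm]
        exact le_mul_of_one_le_right (by positivity) h4
    _ ≤ C' * P.step N ^ 5 + C * P.step N ^ 4 := by
        rw [← hvn]
        exact h1.trans (add_le_add key (H N hN hN0))
    _ ≤ C' * P.step N ^ (k + 1 + 1) + |C| * P.step N ^ (k + 1 + 1) := by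
        gcongr
        exact le_abs_self C
    _ = _ := by ring

lemma reach_nonneg : 0 ≤ M.reach := zero_le_one.trans M.one_le_reach

/-- Uniform consistency of order three requires `Γ_2 = Γ_3 = 0`. -/
lemma HasUniformConsistencyOrder.gamma_eq_zero (H : M.HasUniformConsistencyOrder 3) {k : ℕ}
    (hk : k ≤ 2) {α : ℝ} (hα : α ∈ Icc (0 : ℝ) 1) : M.gamma (k + 1) α = 0 := by
  obtain ⟨l, m, H⟩ := H
  have hR := M.reach_nonneg
  let lag : C(ℝ, Icc (-(M.reach + 1)) (0 : ℝ)) :=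
    ContinuousMap.const ℝ ⟨0, by constructor <;> linarith⟩
  let P := powProblem l m (k + 1) 0 hR lag
  obtain ⟨C, N₀, H⟩ := H P
  refine gamma_eq_zero_of_residual (l := l) (m := m) (μ := 0) (hR := hR) (lag := lag) hk hα
    (C := C) (N₀ := N₀) fun N hN hN0 => ?_
  have hh := P.step_pos hN0
  have := H N hN 1 (by simp; omega) (powProblem_regularStep hN0) α hα
  rw [norm_smul, Real.norm_of_nonneg hh.le]
  refine (mul_le_mul_of_nonneg_left this hh.le).trans (le_of_eq ?_)
  ring

/-- Uniform order three of the one-step error requires `Γ_2 = Γ_3 = 0`. -/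
lemma HasUniformStepOrder.gamma_eq_zero (H : M.HasUniformStepOrder 3) {k : ℕ}
    (hk : k ≤ 2) {α : ℝ} (hα : α ∈ Icc (0 : ℝ) 1) : M.gamma (k + 1) α = 0 := by
  obtain ⟨l, m, H⟩ := H
  have hR := M.reach_nonneg
  let lag : C(ℝ, Icc (-(M.reach + 1)) (0 : ℝ)) :=
    ContinuousMap.const ℝ ⟨0, by constructor <;> linarith⟩
  let P := powProblem l m (k + 1) 0 hR lag
  obtain ⟨C, N₀, H⟩ := H P
  refine gamma_eq_zero_of_residual (l := l) (m := m) (μ := 0) (hR := hR) (lag := lag) hk hα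
    (C := C) (N₀ := N₀) fun N hN hN0 => ?_
  obtain ⟨⟨η, K, Ys, hst⟩, herr⟩ := H N hN 1 (by simp; omega) (powProblem_regularStep hN0)
  have h1 := herr η K Ys hst α hα
  rw [hst.error_eq (P.step_pos hN0).ne' hα] at h1
  -- With `μ = 0` the right-hand side ignores the history, so the stage values are exact and the
  -- error of the step is the residual.
  have h2 : ∀ j, P.exactK (P.mesh N ((1 : ℕ) - 1) + M.c j * P.step N) - K j = 0 := by
    intro j
    rw [hst.stage_value j, SmoothProblem.exactK]
    change powRHS (k + 1) 0 lag _ _ - powRHS (k + 1) 0 lag _ _ = 0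
    simp only [powRHS, zero_smul, sub_self]
  simp only [h2, smul_zero, Finset.sum_const_zero, add_zero] at h1
  exact h1

/-- Uniform order three of the one-step error requires the conditions on `b_i` and `Γ_{i2}`. -/
lemma HasUniformStepOrder.sum_mul_gammaStage_two (H : M.HasUniformStepOrder 3)
    (h_one : M.StageOrderOne) (m : Fin s) {α : ℝ} (hα : α ∈ Icc (0 : ℝ) 1) {β : ℝ}
    (hβ : β ∈ Icc 0 (M.c m)) :
    ∑ i with M.c i = M.c m, (M.b i).eval α * M.gammaStage i 2 β = 0 := by
  have hγ2 := H.gamma_eq_zero (k := 1) (by norm_num) hα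
  rcases (M.c_nonneg m).eq_or_lt with hm | hm
  · have : β = 0 := le_antisymm (hm ▸ hβ.2) hβ.1
    simp [this, gammaStage_zero_right _ two_ne_zero]
  obtain ⟨l, m', H⟩ := H
  obtain ⟨g, R, hg, hR2, hg1, hg2⟩ := exists_selector M.c M.c_nonneg m hm hβ
  have hR := M.reach_nonneg
  let lag : C(ℝ, Icc (-(M.reach + 1)) (0 : ℝ)) :=
    ⟨fun t => projIcc (-(M.reach + 1)) 0 (by linarith) (g t - t), by fun_prop⟩
  have hlag : ∀ t ∈ Icc 0 (M.reach + 1), ((lag t : Icc _ _) : ℝ) = g t - t := by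
    intro t ht
    have := hg1 t ht.1
    change (projIcc (-(M.reach + 1)) 0 (by linarith) (g t - t) : ℝ) = _
    rw [projIcc_of_mem _ ⟨by linarith [this.1, ht.2], by linarith [this.2]⟩]
  set P := powProblem l m' 2 1 hR lag
  obtain ⟨C, N₀, H⟩ := H P
  obtain ⟨B, hB0, hB⟩ := M.exists_coeffBound
  obtain ⟨L, hL⟩ := P.rhs.bounded_fderiv
  have hL0 : 0 ≤ L := (norm_nonneg (fderiv ℝ (P.f 0) 0)).trans (hL 0 0)
  -- The given `l` may be below two, but the same right-hand side and solution also form a problem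
  -- of class `max l 2`, and the bound does not mention `l`.
  obtain ⟨Cq, ρ, hCq, hρ, hq⟩ :=
    (powProblem (max l 2) m' 2 1 hR lag).exists_fderiv_remainder_bound (le_max_right _ _)
  set C' := (2 + B + 2 * s * B) * 24 * M.reach ^ 5
  have hC'0 : 0 ≤ C' := by positivity
  set Cs := C' + B * 24 + 24 + Cq
  obtain ⟨D, hD0, hD⟩ := StageErrors.exists_bound P.r (EuclideanSpace ℝ (Fin P.d)) hB hB0 hL0
    (by positivity : 0 ≤ Cs) hρ
  set βs : Fin s → ℝ := fun j => if M.c j = M.c m then β else 0 with hβs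
  have hβs0 : ∀ j, 0 ≤ βs j := by
    intro j; simp only [hβs]; split_ifs; exacts [hβ.1, le_rfl]
  set S := ∑ j, (M.b j).eval α * M.gammaStage j 2 (βs j) with hS
  have hSeq : S = ∑ i with M.c i = M.c m, (M.b i).eval α * M.gammaStage i 2 β := by
    rw [Finset.sum_filter]
    refine Finset.sum_congr rfl fun j _ => ?_
    simp only [hβs]
    split_ifs
    · rfl
    · rw [gammaStage_zero_right j two_ne_zero, mul_zero]
  rw [← hSeq]
  refine P.eq_zero_of_frequently (D := |C| + C' + s * (B * (Cs + s * (B * D)))) (a := 3) ?_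
  -- The selector takes the desired values only for the step sizes `1 / R^i`, hence the subsequence
  -- `N = R^i`.
  refine (tendsto_pow_atTop_atTop_of_one_lt (by omega : 1 < R)).frequently
    (Eventually.frequently ?_)
  filter_upwards [(tendsto_pow_atTop_atTop_of_one_lt (by omega : 1 < R)).eventually
    ((eventually_ge_atTop N₀).and <| (eventually_gt_atTop 0).and <|
      (eventually_step_le_one P).and <| P.tendsto_step.eventually hD)] with i hi
  have hstep : P.step (R ^ i) = 1 / (R ^ i : ℕ) := powProblem_step _
  set N := R ^ i with hNdef
  obtain ⟨hN, hN0, hN1, hD⟩ := hi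
  have hh := P.step_pos hN0
  have hreg : M.RegularStep P N 1 := powProblem_regularStep hN0
  obtain ⟨⟨η, K, Ys, hst⟩, herr⟩ := H N hN 1 (by simp; omega) hreg
  have hmesh : P.mesh N ((1 : ℕ) - 1) = 0 := powProblem_mesh N
  have hY : P.IsTaylor (P.mesh N ((1 : ℕ) - 1)) (P.step N) M.reach 24 (powTaylor 2) := 
    powProblem_isTaylor hmesh _ (by norm_num)
  have hSE := hst.stageErrors h_one hB hB0 hN0 hN1 hreg (by norm_num) hY hCq hL hq
  have hbd := hD _ _ _ _ _ hSE
  have hX := hSE.X_sub_le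
  have h1 := herr η K Ys hst α hα
  rw [hst.error_eq hh.ne' hα] at h1
  set δ : Fin s → EuclideanSpace ℝ (Fin 1) :=
    fun j => P.exactK (P.mesh N ((1 : ℕ) - 1) + M.c j * P.step N) - K j with hδ
  have hδX : ∀ j, ‖δ j + (P.step N ^ 2 * M.gammaStage j 2 (βs j)) • powTaylor 2 2‖
      ≤ (Cs + s * (B * D)) * P.step N ^ 3 := by
    intro j
    set t := P.mesh N ((1 : ℕ) - 1) + M.c j * P.step N with ht
    have htc : t = M.c j * P.step N := by rw [ht, hmesh, zero_add]
    -- With `μ = 1` the right-hand side reads the history at a single point, so `δ j` is exactly the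
    -- stage error there; by `e2` this point is `βs j` times the step.
    have e1 : (shift P.r P.y t - shift P.r (Ys j) (M.c j * P.step N)) (lag t) = δ j := by
      simp only [hδ]
      rw [hst.stage_value j, SmoothProblem.exactK]
      change _ = powRHS 2 1 lag t _ - powRHS 2 1 lag t _
      simp only [powRHS, one_smul, add_sub_add_left_eq_sub, sub_sub_sub_cancel_right]
      rfl
    have ht0 : 0 ≤ M.c j * P.step N := mul_nonneg (M.c_nonneg j) hh.le
    have ht1 : M.c j * P.step N ≤ M.reach + 1 := by
      have := mul_le_of_le_one_right (M.c_nonneg j) hN1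
      linarith [M.c_le_reach j]
    have e2 : max 0 (M.c j + ((lag t : Icc _ _) : ℝ) / P.step N) = βs j := by
      rw [htc, hlag _ ⟨ht0, ht1⟩]
      have := hg2 i j
      rw [← hNdef, ← hstep] at this
      rw [this, ← sub_mul, mul_div_cancel_right₀ _ hh.ne', add_sub_cancel]
      exact max_eq_right (hβs0 j)
    have e3 := hX j (lag t)
    rw [e1, e2] at e3
    have e4 : powTaylor 2 3 = 0 := by simp [powTaylor]
    rw [e4, smul_zero, add_zero] at e3
    have hβj : βs j ∈ Icc 0 (M.c j) := ⟨hβs0 j, by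
      simp only [hβs]; split_ifs with h
      exacts [h ▸ hβ.2, M.c_nonneg j]⟩
    have e5 : ‖P.step N • ∑ k, (M.a j k).eval (βs j) • δ k‖
        ≤ P.step N * (s * (B * (D * P.step N ^ 2))) :=
      norm_smul_sum_smul_le hh.le (fun k => hB.a j k _ hβj) fun k => (hbd k).2.1
    have e6 : P.step N ^ 4 ≤ P.step N ^ 3 := pow_le_pow_of_le_one hh.le hN1 (by norm_num)
    have e7 : ∀ x y z : EuclideanSpace ℝ (Fin 1), x + z = (x - y + z) + y := by intros; abel
    rw [e7 (δ j) (P.step N • ∑ k, (M.a j k).eval (βs j) • δ k)]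
    refine (norm_add_le _ _).trans ((add_le_add (e3.trans
      (mul_le_mul_of_nonneg_left e6 (by positivity))) e5).trans (le_of_eq ?_))
    ring
  have hsum := norm_smul_sum_smul_le hh.le (fun j => hB.b j α hα) hδX
  have e1 : P.step N • ∑ j, (M.b j).eval α •
      (δ j + (P.step N ^ 2 * M.gammaStage j 2 (βs j)) • powTaylor 2 2)
      = P.step N • ∑ j, (M.b j).eval α • δ j + (P.step N ^ 3 * S) • powTaylor 2 2 := by
    simp only [smul_add, Finset.sum_add_distrib, hS, Finset.mul_sum, Finset.sum_smul,
      Finset.smul_sum, smul_smul]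
    congr 1
    refine Finset.sum_congr rfl fun j _ => ?_
    congr 1
    ring
  rw [e1] at hsum
  have hres := norm_residual_add_le (n := 1) (P := P) hB hN0 (by norm_num : (0 : ℝ) ≤ 24) hY hα
  rw [Finset.sum_eq_single_of_mem 1 (by simp) fun j _ hj => by simp [powTaylor, hj], hγ2,
    mul_zero, zero_smul, add_zero] at hres
  set x := P.step N • M.residual P N 1 α
  set z := P.step N • ∑ j, (M.b j).eval α • δ j
  set v := (P.step N ^ 3 * S) • powTaylor 2 2 with hv
  have hvn : ‖v‖ = P.step N ^ 3 * |S| * 2 := by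
    rw [hv, powTaylor, if_pos rfl, norm_smul_smul_single, abs_mul, abs_of_pos (pow_pos hh _)]
    norm_num
  have h3 : ‖v‖ ≤ ‖z + v‖ + (‖x + z‖ + ‖x‖) := by
    have e : v = (z + v) - ((x + z) - x) := by abel
    calc ‖v‖ = ‖(z + v) - ((x + z) - x)‖ := by rw [← e]
      _ ≤ _ := (norm_sub_le _ _).trans (by gcongr; exact norm_sub_le _ _)
  have h4 : P.step N ^ 5 ≤ P.step N ^ 4 := pow_le_pow_of_le_one hh.le hN1 (by norm_num)
  have h5 : C' * P.step N ^ 5 ≤ C' * P.step N ^ 4 := by gcongr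
  have h6 : C * P.step N ^ 4 ≤ |C| * P.step N ^ 4 := by gcongr; exact le_abs_self C
  have h7 : 0 ≤ P.step N ^ 3 * |S| := by positivity
  have h8 : ‖x + z‖ ≤ C * P.step N ^ 4 := h1
  have h9 : ‖z + v‖ ≤ s * (B * (Cs + s * (B * D))) * P.step N ^ 4 :=
    hsum.trans (le_of_eq (by ring))
  have h10 : P.step N ^ 3 * |S| * 2 ≤ s * (B * (Cs + s * (B * D))) * P.step N ^ 4
      + (C * P.step N ^ 4 + C' * P.step N ^ 5) :=
    hvn.symm.le.trans (h3.trans (add_le_add h9 (add_le_add h8 hres)))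
  calc |S| * P.step N ^ 3 ≤ P.step N ^ 3 * |S| * 2 := by rw [mul_comm |S|]; linarith only [h7]
    _ ≤ s * (B * (Cs + s * (B * D))) * P.step N ^ 4 + (|C| * P.step N ^ 4 + C' * P.step N ^ 4) :=
      h10.trans (add_le_add le_rfl (add_le_add h6 h5))
    _ = _ := by ring

/-! ### Uniform order four. -/

/-- Uniform order of consistency four. -/
lemma hasUniformConsistencyOrder_four (h_one : M.StageOrderOne)
    (h2 : ∀ α ∈ Icc (0 : ℝ) 1, M.gamma 2 α = 0) (h3 : ∀ α ∈ Icc (0 : ℝ) 1, M.gamma 3 α = 0)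
    (h4 : ∀ α ∈ Icc (0 : ℝ) 1, M.gamma 4 α = 0) : M.HasUniformConsistencyOrder 4 := by
  obtain ⟨B, hB0, hB⟩ := M.exists_coeffBound
  refine ⟨0, 5, fun P => ?_⟩
  obtain ⟨C, hC0, hC⟩ := P.exists_isTaylor M le_rfl
  refine ⟨(2 + B + 2 * s * B) * C * M.reach ^ 5, 1, fun N hN n _ hreg α hα => ?_⟩
  have hh := P.step_pos (by omega : 0 < N)
  obtain ⟨Y, hY⟩ := hC N n (by omega) hreg
  have := norm_residual_le hB (by omega) hC0 hY hα (h_one.gamma_one hα) (h2 α hα) (h3 α hα)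
    (h4 α hα)
  rw [norm_smul, Real.norm_of_nonneg hh.le] at this
  refine le_of_mul_le_mul_left (this.trans (le_of_eq ?_)) hh
  ring

end TSRK

theorem mainTheorem4 {s : ℕ} (M : TSRK s) (h_one : M.StageOrderOne)
    (h_four : ∀ α ∈ Set.Icc (0 : ℝ) 1, M.gamma 4 α = 0)
    (h_single : ∀ m : Fin s, ∀ α ∈ Set.Icc (0 : ℝ) 1, ∀ β ∈ Set.Icc (0 : ℝ) (M.c m),
      ∑ i with M.c i = M.c m, (M.b i).eval α * M.gammaStage i 3 β = 0)
    (h_double : ∀ m l : Fin s, ∀ α ∈ Set.Icc (0 : ℝ) 1, ∀ β ∈ Set.Icc (0 : ℝ) (M.c m),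
      ∀ γ ∈ Set.Icc (0 : ℝ) (M.c l),
        ∑ i with M.c i = M.c m, ∑ j with M.c j = M.c l,
          (M.b i).eval α * (M.a i j).eval β * M.gammaStage j 2 γ = 0) :
    (M.HasUniformStepOrder 3 → M.HasUniformStepOrder 4) ∧
    (M.HasUniformConsistencyOrder 3 → M.HasUniformConsistencyOrder 4) := by
  refine ⟨fun H => ?_, fun H => TSRK.hasUniformConsistencyOrder_four h_one
    (fun α hα => H.gamma_eq_zero (k := 1) (by norm_num) hα)
    (fun α hα => H.gamma_eq_zero (k := 2) (by norm_num) hα) h_four⟩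
  have h_two := fun m α hα β hβ =>
    H.sum_mul_gammaStage_two h_one m (α := α) hα (β := β) hβ
  have hγ2 := fun α hα => H.gamma_eq_zero (k := 1) (by norm_num) (α := α) hα
  have hγ3 := fun α hα => H.gamma_eq_zero (k := 2) (by norm_num) (α := α) hα
  obtain ⟨B, hB0, hB⟩ := M.exists_coeffBound
  obtain ⟨l, m, H⟩ := H
  -- Two derivatives of `f` give the quadratic remainder in the stage values, five of `y` a residual
  -- up to `O(h^5)`; `l` and `m` keep order three applicable.
  refine ⟨max l 2, max m 5, fun P => ?_⟩
  obtain ⟨C₀, N₀, H⟩ := H (P.weaken (le_max_left _ _) (le_max_left _ _))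
  obtain ⟨C, hC0, hC⟩ := P.exists_isTaylor M (le_max_right _ _)
  obtain ⟨L, hL⟩ := P.rhs.bounded_fderiv
  have hL0 : 0 ≤ L := (norm_nonneg (fderiv ℝ (P.f 0) 0)).trans (hL 0 0)
  obtain ⟨Cq, ρ, hCq, hρ, hq⟩ := P.exists_fderiv_remainder_bound (le_max_right _ _)
  have hR := M.reach_nonneg
  set C' := (2 + B + 2 * s * B) * C * M.reach ^ 5
  have hC'0 : 0 ≤ C' := by positivity
  obtain ⟨D, hD0, hD⟩ := TSRK.StageErrors.exists_sum_bound P.r (EuclideanSpace ℝ (Fin P.d)) hB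
    hB0 hL0 (by positivity : 0 ≤ C' + B * C + C + Cq) hρ h_two h_single h_double
  obtain ⟨N₁, hN₁⟩ := eventually_atTop.1 ((eventually_ge_atTop N₀).and <|
    (eventually_gt_atTop 0).and <| (TSRK.eventually_step_le_one P).and <|
      P.tendsto_step.eventually hD)
  refine ⟨C' + D, N₁, fun N hN n hn hreg => ?_⟩
  obtain ⟨hN0, hNpos, hN1, hDN⟩ := hN₁ N hN
  -- Solvability of the step is inherited from order three; only the error bound has to be improved.
  refine ⟨(H N hN0 n hn hreg).1, fun η K Ys hst α hα => ?_⟩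
  have hh := P.step_pos hNpos
  obtain ⟨Y, hY⟩ := hC N n hNpos hreg
  have hSE := hst.stageErrors h_one hB hB0 hNpos hN1 hreg hC0 hY hCq hL hq
  have h1 := hDN _ _ _ _ _ hSE α hα
  have h2 := TSRK.norm_residual_le hB hNpos hC0 hY hα (h_one.gamma_one hα) (hγ2 α hα)
    (hγ3 α hα) (h_four α hα)
  rw [hst.error_eq hh.ne' hα]
  refine (norm_add_le _ _).trans ?_
  rw [norm_smul (P.step N) (∑ j, _), Real.norm_of_nonneg hh.le]
  have h3 := mul_le_mul_of_nonneg_left h1 hh.le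
  refine (add_le_add h2 h3).trans (le_of_eq ?_)
  ring

end
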